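/- **Setting.** Let $A$ be a finite alphabet and let $\mathcal P^d=\{\mu_\theta:\theta\in\Theta\}$, with $\Theta\subset\mathbb R^d$ open and $d\ge1$, be an identifiable family ($\theta\mapsto\mu_\theta$ is injective) of stationary sources over $A$ of memory at most $h$ (Markov of order $h$), whose word probabilities are positive and twice continuously differentiable in $\theta$. Let $\mathcal I(\theta)$ be the limit as $n\to\infty$ of the normalized Fisher information matrix $\mathcal I_n(\theta)=\frac1{n\log e}\mathbf E\,\partial_i\partial_j\log\frac1{\mu_\theta(X^n)}$, assume $0<\int_\Theta|\mathcal I(\theta)|^{1/2}d\theta<\infty$, and let Jeffreys' prior be the probability measure on $\Theta$ with density proportional to $|\mathcal I(\theta)|^{1/2}$. Logarithms are in base 2. A length function is a function $l:A^n\to\mathbb R$ with $\sum_x2^{-l(x)}\le1$; $H_n(\theta)$ is the entropy of $X^n\sim\mu_\theta$, $R_n(l,\theta)=\mathbf E\,l(X^n)-H_n(\theta)$, and $\bar R_n=\inf_l\sup_\theta R_n(l,\theta)$ is the average minimax redundancy. Let $\mathcal K\ge2$, let $\theta^{(1)},\dots,\theta^{(\mathcal K)}$ be independent and Jeffreys-distributed,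 and let $p_1,\dots,p_{\mathcal K}>0$ with $\sum_ip_i=1$. The memory $\mathbf y$ consists of $T$ sequences; the $j$-th ($0\le j<T$) has length $n_j$ and comes from the source $\theta^{(Z_j)}$, where the $Z_j$ are i.i.d. with law $\mathbf p$; given the parameters and the $Z_j$, the sequences are independent. Let $m=\sum_{j<T}n_j$. Fix a tree depth $\mathcal D\ge0$ and assume $n_j>\mathcal D$ for all $j$ and $n_T/\sum_{j<T}n_j\to0$ as $T\to\infty$; "$m\to\infty$" means $T\to\infty$. Let $\phi=\theta^{(i)}$, for any $i$, be the parameter of the new sequence $x^n$. *Ucomp* uses length functions $l_n$ with $\sup_\theta R_n(l_n,\theta)\le\bar R_n+c$ for all $n$, with some constant $c$. *UcompM* uses the length function $l_{n|\mathbf m}=-\log q(x^n\mid\mathbf y)$, where $q$ encodes the symbols one after the other, the $t$-th in the context $s$ of its $\min(t-1,\mathcal D)$ predecessors, with the estimator $(c(sa)+\alpha)/\sum_b(c(sb)+\alpha)$, for a fixed $\alpha>0$; here $c(w)$ counts the occurrences of $w$ in the memorized sequences and in $x_1\dots x_{t-1}$. Let $Q=\mathbf E\,l_n(X^n)/\mathbf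 E\,l_{n|\mathbf m}(X^n)$, with $X^n\sim\mu_\phi$, and $$g_{\mathrm M}(n,m,\phi,\epsilon,\mathbf p)=\mathbf E_{Z_0,\dots,Z_{T-1}}\sup\{r:\mathbf P[Q\ge r\mid Z_0,\dots,Z_{T-1}]\ge1-\epsilon\}.$$ Let $\bar\mu(w)=\sum_ip_i\mu_{\theta^{(i)}}(w)$ and $\bar\mu_\theta^{\mathcal D}(x^n)=\prod_{t=1}^n\bar\mu(s_tx_t)/\bar\mu(s_t)$, where $s_t$ is the word of the $\min(t-1,\mathcal D)$ symbols before $x_t$. Put $D_n=D_n(\mu_\phi\|\bar\mu_\theta^{\mathcal D})$ and $$B_n=\frac{H_n(\phi)+\bar R_n}{H_n(\phi)+D_n(\mu_\phi\|\bar\mu_\theta^{\mathcal D})}.$$ **Claim.** There is a measurable function $C$ of $(\theta^{(1)},\dots,\theta^{(\mathcal K)})$, which depends neither on $n$ nor on $\epsilon$, such that: 1. For almost every $(\theta^{(1)},\dots,\theta^{(\mathcal K)})$ and every choice of $\phi=\theta^{(i)}$, with $\mathbf P$ taken over the memory for these given parameters: for all $n\ge1$ and $0<\epsilon<1$ the limit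 $g_{\mathrm M}(n,\infty,\phi,\epsilon,\mathbf p)=\lim_{m\to\infty}g_{\mathrm M}(n,m,\phi,\epsilon,\mathbf p)$ exists and $$g_{\mathrm M}(n,\infty,\phi,\epsilon,\mathbf p)\le\frac{H_n(\phi)+\bar R_n}{H_n(\phi)+D_n(\mu_\phi\|\bar\mu_\theta^{\mathcal D})}+\frac Cn;$$ moreover $D_n(\mu_\phi\|\bar\mu_\theta^{\mathcal D})=\Theta(n)$, and there is $n_0$ such that $g_{\mathrm M}(n,\infty,\phi,\epsilon,\mathbf p)<1$ for all $n\ge n_0$ and all $0<\epsilon<1$. 2. With $\mathbf P$ taken jointly over the Jeffreys-distributed parameters and the memory, for every $i$ and every $0<\epsilon<1$: for all $n\ge1$, $$\limsup_{m\to\infty}g_{\mathrm M}(n,m,\phi,\epsilon,\mathbf p)\le\sup\{r:\mathbf P[B_n+C/n\ge r]\ge1-\epsilon\},$$ and $\limsup_{m\to\infty}g_{\mathrm M}(n,m,\phi,\epsilon,\mathbf p)<1$ for all sufficiently large $n$. -/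

import Mathlib

open MeasureTheory Filter Topology Asymptotics

noncomputable section

namespace MemoryAssisted

/-- A stationary source over the finite alphabet `A`: the law of a stationary `A`-valued process,
given by the probabilities `prob w` of seeing the word `w` (at any fixed position). -/
structure StationarySource (A : Type*) [Fintype A] where
  prob : List A → ℝ
  prob_nil : prob [] = 1
  prob_nonneg : ∀ w, 0 ≤ prob w
  sum_append : ∀ w, ∑ a, prob (w ++ [a]) = prob w
  sum_cons : ∀ w, ∑ a, prob (a :: w) = prob w

/-- The source has memory at most `h`: given the last `h` symbols `w`, the next symbol does not
depend on the earlier past `u`. -/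
def StationarySource.HasMemory {A : Type*} [Fintype A] (μ : StationarySource A) (h : ℕ) : Prop :=
  ∀ (u w : List A) (a : A), w.length = h →
    μ.prob (u ++ w ++ [a]) * μ.prob w = μ.prob (u ++ w) * μ.prob (w ++ [a])

/-- The law of the first `n` symbols. -/
def StationarySource.law {A : Type*} [Fintype A] (μ : StationarySource A) {n : ℕ}
    (x : Fin n → A) : ℝ :=
  μ.prob (List.ofFn x)

/-- A `d`-parameter family of stationary sources of memory at most `h`, with an open parameter
set `Θ`. Distinct parameters give distinct sources, and word probabilities are positive and twice
continuously differentiable in the parameter. The values of `source` outside `Θ` play no role. -/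
structure ParametricFamily (A : Type*) [Fintype A] (d h : ℕ) where
  Θ : Set (Fin d → ℝ)
  isOpen : IsOpen Θ
  source : (Fin d → ℝ) → StationarySource A
  memory : ∀ θ ∈ Θ, (source θ).HasMemory h
  pos : ∀ θ ∈ Θ, ∀ w, 0 < (source θ).prob w
  smooth : ∀ w, ContDiffOn ℝ 2 (fun θ => (source θ).prob w) Θ
  identifiable : Set.InjOn source Θ

/-- `E f(X^n)` for `X^n` drawn from the source `μ`. -/
def expect {A : Type*} [Fintype A] (μ : StationarySource A) {n : ℕ} (f : (Fin n → A) → ℝ) : ℝ :=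
  ∑ x, μ.law x * f x

/-- The entropy (in bits) of `n` symbols. -/
def entropy {A : Type*} [Fintype A] (μ : StationarySource A) (n : ℕ) : ℝ :=
  expect μ fun x : Fin n → A => Real.logb 2 (1 / μ.law x)

/-- The relative entropy (in bits) of the law of `n` symbols of `μ` from `q`. -/
def divergence {A : Type*} [Fintype A] (μ : StationarySource A) {n : ℕ}
    (q : (Fin n → A) → ℝ) : ℝ :=
  expect μ fun x => Real.logb 2 (μ.law x / q x)

/-- Length functions are (ideal) code lengths in bits that satisfy Kraft's inequality. -/
def IsLengthFunction {A : Type*} [Fintype A] {n : ℕ} (l : (Fin n → A) → ℝ) : Prop :=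
  ∑ x, (2 : ℝ) ^ (-l x) ≤ 1

/-- The expected redundancy `R_n(l, μ)`. -/
def redundancy {A : Type*} [Fintype A] (μ : StationarySource A) {n : ℕ}
    (l : (Fin n → A) → ℝ) : ℝ :=
  expect μ l - entropy μ n

namespace ParametricFamily

variable {A : Type*} [Fintype A] {d h : ℕ} (F : ParametricFamily A d h)

/-- The average (i.e. expected) minimax redundancy. -/
def minimaxRedundancy (n : ℕ) : ℝ :=
  ⨅ l : {l : (Fin n → A) → ℝ // IsLengthFunction l}, ⨆ θ : F.Θ, redundancy (F.source θ) l.1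

/-- A universal code for the family: for every `n` a length function whose worst-case expected
redundancy is minimax, up to a number of bits that does not depend on `n`. -/
def IsUniversal (l : ∀ n, (Fin n → A) → ℝ) : Prop :=
  (∀ n, IsLengthFunction (l n)) ∧
    ∃ c : ℝ, ∀ n, ∀ θ ∈ F.Θ, redundancy (F.source θ) (l n) ≤ F.minimaxRedundancy n + c

/-- The normalized Fisher information matrix of `n` symbols. -/
def fisherN (n : ℕ) (θ : Fin d → ℝ) : Matrix (Fin d) (Fin d) ℝ :=
  Matrix.of fun i j => 1 / (n * Real.logb 2 (Real.exp 1)) *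
    expect (F.source θ) fun x : Fin n → A =>
      lineDeriv ℝ
        (fun θ' => lineDeriv ℝ (fun θ'' => Real.logb 2 (1 / (F.source θ'').law x)) θ'
          (Pi.single j 1))
        θ (Pi.single i 1)

/-- The Fisher information matrix of the family (per symbol). -/
def fisher (θ : Fin d → ℝ) : Matrix (Fin d) (Fin d) ℝ :=
  Matrix.of fun i j => limUnder atTop fun n => F.fisherN n θ i j

/-- The normalizing integral of Jeffreys' prior. -/
def jeffreysMass : ENNReal :=
  ∫⁻ θ in F.Θ, ENNReal.ofReal (Real.sqrt (F.fisher θ).det)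

/-- Jeffreys' prior. -/
def jeffreys : Measure (Fin d → ℝ) :=
  F.jeffreysMass⁻¹ •
    (volume.restrict F.Θ).withDensity fun θ => ENNReal.ofReal (Real.sqrt (F.fisher θ).det)

/-- The law of `K` independent parameter vectors, each following Jeffreys' prior. -/
def prior (K : ℕ) : Measure (Fin K → Fin d → ℝ) :=
  Measure.pi fun _ => F.jeffreys

end ParametricFamily

/-- The context of position `t` in `x`: the last `D` symbols before it, or all the symbols before
it if there are fewer than `D`. -/
def context {A : Type*} (D : ℕ) {n : ℕ} (x : Fin n → A) (t : Fin n) : List A :=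
  ((List.ofFn x).take t).drop (t - D)

section Mixture

variable {A : Type*} [Fintype A] {d h : ℕ} (F : ParametricFamily A d h) {K : ℕ}
  (p : Fin K → ℝ) (θ : Fin K → Fin d → ℝ)

/-- Word probabilities of the mixture of the sources `θ 1, …, θ K` with weights `p`. -/
def mixtureProb (w : List A) : ℝ :=
  ∑ i, p i * (F.source (θ i)).prob w

/-- The measure on sequences of length `n` defined on the context tree of depth `D` from the
mixture: each symbol has the conditional probability, under the mixture, given its context. -/
def treeMixture (D n : ℕ) (x : Fin n → A) : ℝ :=
  ∏ t, mixtureProb F p θ (context D x t ++ [x t]) / mixtureProb F p θ (context D x t)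

/-- `(H_n(φ) + R̄_n) / (H_n(φ) + D_n(μ_φ ‖ μ̄))` for `φ = θ i`. -/
def mainTerm (D : ℕ) (i : Fin K) (n : ℕ) : ℝ :=
  (entropy (F.source (θ i)) n + F.minimaxRedundancy n) /
    (entropy (F.source (θ i)) n + divergence (F.source (θ i)) (treeMixture F p θ D n))

end Mixture

section Code

variable {A : Type*} [Fintype A] [DecidableEq A]

/-- The number of (possibly overlapping) occurrences of the nonempty word `w` in `y`. -/
def occ (w y : List A) : ℕ :=
  y.tails.countP fun s => decide (w <+: s)

/-- The sequences memorized from `T` transmissions, the `j`-th of length `N j`. -/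
abbrev Memory (A : Type*) (N : ℕ → ℕ) (T : ℕ) : Type _ :=
  ∀ j : Fin T, Fin (N j) → A

/-- The number of occurrences of `w` in the memorized sequences and in the part of `x` that
precedes position `t`. -/
def count {N : ℕ → ℕ} {T : ℕ} (y : Memory A N T) {n : ℕ} (x : Fin n → A) (t : Fin n)
    (w : List A) : ℕ :=
  ∑ j, occ w (List.ofFn (y j)) + occ w ((List.ofFn x).take t)

/-- The coding probability of `x` in UcompM: the symbols are encoded one after the other on the
context tree of depth `D`, with the additive estimator of bias `α` (Krichevsky–Trofimov for
`α = 1/2`) that is computed from the symbol counts in the context of the current symbol. All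
memorized sequences are used, whatever source they come from. -/
def memoryCode (D : ℕ) (α : ℝ) {N : ℕ → ℕ} {T : ℕ} (y : Memory A N T) {n : ℕ}
    (x : Fin n → A) : ℝ :=
  ∏ t, (count y x t (context D x t ++ [x t]) + α) /
    ∑ b, (count y x t (context D x t ++ [b]) + α)

/-- The length function of UcompM. -/
def memoryLength (D : ℕ) (α : ℝ) {N : ℕ → ℕ} {T : ℕ} (y : Memory A N T) {n : ℕ}
    (x : Fin n → A) : ℝ :=
  Real.logb 2 (1 / memoryCode D α y x)

variable {d h : ℕ} (F : ParametricFamily A d h) {K : ℕ}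

/-- The ratio `Q` of the expected length with `l` to that of UcompM with memory `y`, for `X^n` from
the source `μ`. -/
def lengthRatio (μ : StationarySource A) {n : ℕ} (l : (Fin n → A) → ℝ) (D : ℕ) (α : ℝ)
    {N : ℕ → ℕ} {T : ℕ} (y : Memory A N T) : ℝ :=
  expect μ l / expect μ (memoryLength D α y (n := n))

/-- The probability of the memory `y`, given the parameter vectors `θ` and the indices `z` of the
sources that have generated the memorized sequences. -/
def memoryProb (θ : Fin K → Fin d → ℝ) {N : ℕ → ℕ} {T : ℕ} (z : Fin T → Fin K)
    (y : Memory A N T) : ℝ :=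
  ∏ j, (F.source (θ (z j))).law (y j)

open Classical in
/-- `P[Q ≥ r]`, given the source indices `z` of the memorized sequences, when the new sequence comes
from source `i`, the parameter vectors have the joint law `ν`, and the memorized sequences are
independent given the parameter vectors. -/
def probRatioGE (ν : Measure (Fin K → Fin d → ℝ)) (D : ℕ) (α : ℝ) (N : ℕ → ℕ) {T : ℕ}
    (z : Fin T → Fin K) (i : Fin K) {n : ℕ} (l : (Fin n → A) → ℝ) (r : ℝ) : ENNReal :=
  ∫⁻ θ, ENNReal.ofReal (∑ y : Memory A N T,
    if r ≤ lengthRatio (F.source (θ i)) l D α y then memoryProb F θ z y else 0) ∂ν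

/-- The gain of UcompM over `l` given `z`: the largest `r` that the ratio `Q` reaches with probability
at least `1 - ε`. -/
def gain (ν : Measure (Fin K → Fin d → ℝ)) (D : ℕ) (α : ℝ) (N : ℕ → ℕ) {T : ℕ}
    (z : Fin T → Fin K) (i : Fin K) {n : ℕ} (l : (Fin n → A) → ℝ) (ε : ℝ) : ℝ :=
  sSup {r : ℝ | ENNReal.ofReal (1 - ε) ≤ probRatioGE F ν D α N z i l r}

/-- The memorization gain of UcompM with a memory of `T` sequences: the expectation of the gain over
the source indices of the memorized sequences, which are independent with distribution `p`. -/
def gainM (ν : Measure (Fin K → Fin d → ℝ)) (p : Fin K → ℝ) (D : ℕ) (α : ℝ) (N : ℕ → ℕ)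
    (i : Fin K) {n : ℕ} (l : (Fin n → A) → ℝ) (ε : ℝ) (T : ℕ) : ℝ :=
  ∑ z : Fin T → Fin K, (∏ j, p (z j)) * gain F ν D α N z i l ε

end Code

/-- The largest `r` that `X` reaches with probability at least `1 - ε` under `ν`. -/
def reachedLevel {Ω : Type*} [MeasurableSpace Ω] (ν : Measure Ω) (ε : ℝ) (X : Ω → ℝ) : ℝ :=
  sSup {r : ℝ | ENNReal.ofReal (1 - ε) ≤ ν {ω | r ≤ X ω}}

end MemoryAssisted

end

/-!
Only three properties of Jeffreys' prior are used: it is a probability measure, it charges only the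
parameter set, and it has a density, so that it has no atoms. The Fisher information itself plays no
role.

*The limit of the gain.* Averaged over the source indices, the memorized sequences are independent
and follow the law of the mixture (`sum_mul_memoryProb`). By stationarity the expected number of
occurrences of a word is exactly the number of its positions times its mixture probability
(`sum_mul_occ`), and since no single sequence matters in the limit (`isLittleO_sum_sq`), Chebyshev's
inequality with the trivial bound for the variances shows that the empirical frequencies converge in
probability (`tendsto_prob_occ`); no mixing property of the sources is needed. The length ratio is a
continuous function of finitely many frequencies, so it converges in probability to
`E l / (H_n + D_n)`, the `limitRatio` (`tendsto_prob_lengthRatio`). As the gain given the source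
indices is a quantile of the length ratio and is bounded, the memorization gain is governed by the
quantiles of the limit ratio (`eventually_gainM_le`, `tendsto_gainM_dirac`).

*The bound.* Universality of `l` gives `E l ≤ H_n + R̄_n + c`, and the expected code length
`H_n + D_n` of the tree measure is at least a positive constant times `n`
(`le_symbolsPerBit_mul`), which turns `c / (H_n + D_n)` into `C / n`.

*Values below one.* The redundancy `R̄_n` is at most logarithmic, by a two-part code that describes
first the Markov type of a word and then its index within the type
(`exists_lengthFunction_redundancy_le`). The divergence `D_n` is an affine function of `n` once `n`
exceeds all memories, whose slope is the conditional divergence of a symbol given its past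
(`divergence_seqCode_eq`). The slope vanishes only if the source has the conditional probabilities
of the mixture given `D` symbols. Then these are also the conditional probabilities of the rest of
the mixture (`prob_concat_of_mixture`), and as they determine a stationary source
(`eq_of_prob_concat`), the parameter vector of the source is a function of the other parameter
vectors. This has probability zero, because the prior has no atoms (`ae_condDivergence_pos`).
-/

namespace MemoryAssisted

/-! ### Sums over words -/

theorem sum_fin_snoc {A M : Type*} [Fintype A] [AddCommMonoid M] {n : ℕ}
    (f : (Fin (n + 1) → A) → M) :
    ∑ x, f x = ∑ x : Fin n → A, ∑ a, f (Fin.snoc (α := fun _ => A) x a) := by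
  rw [← (Fin.snocEquiv (fun _ => A)).sum_comp, Fintype.sum_prod_type, Finset.sum_comm]
  rfl

theorem sum_fin_cons {A M : Type*} [Fintype A] [AddCommMonoid M] {n : ℕ}
    (f : (Fin (n + 1) → A) → M) :
    ∑ x, f x = ∑ a, ∑ x : Fin n → A, f (Fin.cons (α := fun _ => A) a x) := by
  rw [← (Fin.consEquiv (fun _ => A)).sum_comp, Fintype.sum_prod_type]
  rfl

theorem ofFn_fin_snoc {A : Type*} {n : ℕ} (x : Fin n → A) (a : A) :
    List.ofFn (Fin.snoc (α := fun _ => A) x a) = List.ofFn x ++ [a] := by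
  rw [List.ofFn_succ']
  simp

theorem ofFn_fin_cons {A : Type*} {n : ℕ} (x : Fin n → A) (a : A) :
    List.ofFn (Fin.cons (α := fun _ => A) a x) = a :: List.ofFn x := by
  simp [List.ofFn_succ]

theorem sum_ofFn_append {A : Type*} [Fintype A] {f : List A → ℝ}
    (hf : ∀ w, ∑ a, f (a :: w) = f w) (n : ℕ) (w : List A) :
    ∑ x : Fin n → A, f (List.ofFn x ++ w) = f w := by
  induction n generalizing w with
  | zero => simp
  | succ n ih =>
    rw [sum_fin_snoc, Finset.sum_comm, ← hf w]
    refine Finset.sum_congr rfl fun a _ => ?_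
    rw [← ih (a :: w)]
    simp only [ofFn_fin_snoc, List.append_assoc, List.singleton_append]

theorem sum_append_ofFn {A : Type*} [Fintype A] {f : List A → ℝ}
    (hf : ∀ w, ∑ a, f (w ++ [a]) = f w) (n : ℕ) (w : List A) :
    ∑ x : Fin n → A, f (w ++ List.ofFn x) = f w := by
  induction n generalizing w with
  | zero => simp
  | succ n ih =>
    rw [sum_fin_cons, ← hf w]
    refine Finset.sum_congr rfl fun a _ => ?_
    rw [← ih (w ++ [a])]
    simp

theorem sum_prefix {A : Type*} [Fintype A] [DecidableEq A] {f : List A → ℝ}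
    (hf : ∀ w, ∑ a, f (w ++ [a]) = f w) (w : List A) {n : ℕ} (hn : w.length ≤ n) :
    ∑ x : Fin n → A, (if w <+: List.ofFn x then f (List.ofFn x) else 0) = f w := by
  induction w generalizing n f with
  | nil => simpa using sum_append_ofFn hf n []
  | cons b w ih =>
    obtain ⟨n, rfl⟩ : ∃ k, n = k + 1 := ⟨n - 1, by simp at hn; omega⟩
    rw [sum_fin_cons, Finset.sum_eq_single b]
    · rw [← ih (f := fun v => f (b :: v)) (fun v => hf (b :: v)) (n := n) (by simpa using hn)]
      simp only [ofFn_fin_cons, List.cons_prefix_cons, true_and]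
    · intro a _ hab
      simp [List.cons_prefix_cons, hab.symm]
    · simp

theorem occ_nil {A : Type*} [DecidableEq A] {w : List A} (hw : w ≠ []) : occ w [] = 0 := by
  simp [occ, hw]

theorem occ_cons {A : Type*} [DecidableEq A] (w y : List A) (a : A) :
    occ w (a :: y) = occ w y + if w <+: a :: y then 1 else 0 := by
  simp [occ, List.countP_cons]

theorem occ_le_length {A : Type*} [DecidableEq A] {w : List A} (hw : w ≠ []) (y : List A) :
    occ w y ≤ y.length := by
  induction y with
  | nil => simp [occ_nil hw]
  | cons a y ih =>
    rw [occ_cons, List.length_cons]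
    split_ifs <;> omega

/-- By stationarity, a word occurs on average as often as the number of its possible positions times
its probability. -/
theorem sum_mul_occ {A : Type*} [Fintype A] [DecidableEq A] {f : List A → ℝ}
    (hf : ∀ w, ∑ a, f (w ++ [a]) = f w) (hf' : ∀ w, ∑ a, f (a :: w) = f w)
    {w : List A} (hw : w ≠ []) (n : ℕ) :
    ∑ x : Fin n → A, f (List.ofFn x) * occ w (List.ofFn x) = (n + 1 - w.length : ℕ) * f w := by
  have hpos : 0 < w.length := List.length_pos_iff.2 hw
  induction n with
  | zero =>
    have : 0 + 1 - w.length = 0 := by omega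
    simp [occ_nil hw, this]
  | succ n ih =>
    have h1 : ∑ x : Fin (n + 1) → A, f (List.ofFn x) * occ w (List.ofFn x)
        = ∑ x : Fin n → A, f (List.ofFn x) * occ w (List.ofFn x)
          + ∑ x : Fin (n + 1) → A, (if w <+: List.ofFn x then f (List.ofFn x) else 0) := by
      rw [sum_fin_cons, sum_fin_cons (n := n)
        (fun x => if w <+: List.ofFn x then f (List.ofFn x) else 0), Finset.sum_comm]
      rw [Finset.sum_comm (s := Finset.univ (α := A)), ← Finset.sum_add_distrib]
      refine Finset.sum_congr rfl fun x _ => ?_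
      rw [← hf' (List.ofFn x), Finset.sum_mul, ← Finset.sum_add_distrib]
      refine Finset.sum_congr rfl fun a _ => ?_
      rw [ofFn_fin_cons, occ_cons]
      split_ifs <;> push_cast <;> ring
    rw [h1, ih]
    by_cases hn : w.length ≤ n + 1
    · rw [sum_prefix hf w hn, Nat.succ_sub hn]
      push_cast
      ring
    · have h2 : ∀ x : Fin (n + 1) → A, ¬ w <+: List.ofFn x := fun x hx => hn (by
        simpa using hx.length_le)
      have h3 : n + 1 - w.length = 0 := by omega
      have h4 : n + 1 + 1 - w.length = 0 := by omega
      simp only [h2, h3, h4, if_false, Finset.sum_const_zero]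
      simp

/-- The finite set of words of length at most `k`. -/
noncomputable def shortWords (A : Type*) [Fintype A] (k : ℕ) : Finset (List A) :=
  (List.finite_length_le A k).toFinset

theorem mem_shortWords {A : Type*} [Fintype A] {k : ℕ} {w : List A} :
    w ∈ shortWords A k ↔ w.length ≤ k := by
  simp [shortWords]

theorem length_rtake {A : Type*} (w : List A) (D : ℕ) : (w.rtake D).length = min w.length D := by
  simp [List.rtake]
  omega

theorem rtake_append_of_length {A : Type*} (v w : List A) :
    (v ++ w).rtake w.length = w := by
  simp [List.rtake]

theorem rtake_of_length_le {A : Type*} {w : List A} {D : ℕ} (h : w.length ≤ D) :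
    w.rtake D = w := by
  simp [List.rtake, h]

theorem rtake_cons {A : Type*} (a : A) {w : List A} {D : ℕ} (h : D ≤ w.length) :
    (a :: w).rtake D = w.rtake D := by
  simp [List.rtake, Nat.succ_sub h]

theorem exists_append_rtake {A : Type*} (w : List A) (D : ℕ) : ∃ v, w = v ++ w.rtake D :=
  ⟨w.take (w.length - D), by simp [List.rtake]⟩

theorem rtake_rtake {A : Type*} (w : List A) {D H : ℕ} (h : D ≤ H) :
    (w.rtake H).rtake D = w.rtake D := by
  simp only [List.rtake, List.drop_drop, List.length_drop]
  congr 1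
  omega

/-- Under a stationary law, the expectation of a function of the last `H` symbols does not depend on
the number of symbols before them. -/
theorem sum_mul_rtake {A : Type*} [Fintype A] {f : List A → ℝ}
    (hf : ∀ w, ∑ a, f (a :: w) = f w) (g : List A → ℝ) {H n : ℕ} (hn : H ≤ n) :
    ∑ x : Fin n → A, f (List.ofFn x) * g ((List.ofFn x).rtake H)
      = ∑ u : Fin H → A, f (List.ofFn u) * g (List.ofFn u) := by
  induction n, hn using Nat.le_induction with
  | base =>
    refine Finset.sum_congr rfl fun u _ => ?_
    rw [rtake_of_length_le (List.length_ofFn).le]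
  | succ n hn ih =>
    rw [sum_fin_cons, Finset.sum_comm, ← ih]
    refine Finset.sum_congr rfl fun x _ => ?_
    rw [← hf (List.ofFn x), Finset.sum_mul]
    refine Finset.sum_congr rfl fun a _ => ?_
    rw [ofFn_fin_cons, rtake_cons _ (by simp [hn])]

/-! ### Sequential codes -/

/-- The word function of a sequential code: `q w a` is the probability given to the next symbol `a`
after the symbols `w`. The laws of sources, the tree measure of a mixture and the coding
probabilities with memory are all of this form. -/
def seqCode {A : Type*} (q : List A → A → ℝ) {n : ℕ} (x : Fin n → A) : ℝ :=
  ∏ t : Fin n, q ((List.ofFn x).take t) (x t)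

theorem seqCode_snoc {A : Type*} (q : List A → A → ℝ) {n : ℕ} (x : Fin n → A) (a : A) :
    seqCode q (Fin.snoc (α := fun _ => A) x a) = seqCode q x * q (List.ofFn x) a := by
  simp only [seqCode, Fin.prod_univ_castSucc, Fin.snoc_castSucc, Fin.snoc_last, ofFn_fin_snoc]
  congr 1
  · refine Finset.prod_congr rfl fun t _ => ?_
    rw [List.take_append_of_le_length (by simp)]
    simp
  · rw [List.take_left' (by simp)]

theorem seqCode_pos {A : Type*} {q : List A → A → ℝ} (hq : ∀ w a, 0 < q w a) {n : ℕ}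
    (x : Fin n → A) : 0 < seqCode q x :=
  Finset.prod_pos fun _ _ => hq _ _

theorem sum_seqCode {A : Type*} [Fintype A] {q : List A → A → ℝ} (hq : ∀ w, ∑ a, q w a = 1)
    (n : ℕ) : ∑ x : Fin n → A, seqCode q x = 1 := by
  induction n with
  | zero => simp [seqCode]
  | succ n ih =>
    rw [sum_fin_snoc, ← ih]
    refine Finset.sum_congr rfl fun x _ => ?_
    simp only [seqCode_snoc, ← Finset.mul_sum, hq, mul_one]

theorem context_eq_rtake {A : Type*} (D : ℕ) {n : ℕ} (x : Fin n → A) (t : Fin n) :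
    context D x t = ((List.ofFn x).take t).rtake D := by
  have : ((List.ofFn x).take t).length = t := by simp
  rw [context, List.rtake, this]

/-! ### Sources -/

section Source

variable {A : Type*} [Fintype A] (μ : StationarySource A)

theorem StationarySource.ext_prob {μ ν : StationarySource A} (h : ∀ w, μ.prob w = ν.prob w) :
    μ = ν := by
  cases μ
  cases ν
  congr
  exact funext h

theorem sum_law (n : ℕ) : ∑ x : Fin n → A, μ.law x = 1 := by
  simpa [StationarySource.law, μ.prob_nil] using sum_append_ofFn μ.sum_append n []

theorem law_nonneg {n : ℕ} (x : Fin n → A) : 0 ≤ μ.law x := μ.prob_nonneg _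

theorem law_snoc {n : ℕ} (x : Fin n → A) (a : A) :
    μ.law (Fin.snoc (α := fun _ => A) x a) = μ.prob (List.ofFn x ++ [a]) := by
  rw [StationarySource.law, ofFn_fin_snoc]

variable {μ} in
/-- A source of memory at most `h` has memory at most every larger number. -/
theorem prob_append_mul_of_hasMemory (hpos : ∀ w, 0 < μ.prob w) {h : ℕ} (hμ : μ.HasMemory h)
    (u w : List A) (a : A) (hw : h ≤ w.length) :
    μ.prob (u ++ w ++ [a]) * μ.prob w = μ.prob (u ++ w) * μ.prob (w ++ [a]) := by
  obtain ⟨v, hv⟩ := exists_append_rtake w h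
  have hl : (w.rtake h).length = h := by rw [length_rtake]; omega
  generalize w.rtake h = s at hv hl
  subst hv
  have h1 := hμ (u ++ v) s a hl
  have h2 := hμ v s a hl
  rw [← List.append_assoc u v s]
  have h3 := hpos s
  refine mul_right_cancel₀ h3.ne' ?_
  linear_combination μ.prob (v ++ s) * h1 - μ.prob (u ++ v ++ s) * h2

/-- The probability of the next symbol given the past depends only on the last `h` symbols. -/
theorem prob_concat_div {μ : StationarySource A} (hpos : ∀ w, 0 < μ.prob w) {h : ℕ}
    (hμ : μ.HasMemory h) {H : ℕ} (hH : h ≤ H) (w : List A) (a : A) :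
    μ.prob (w ++ [a]) / μ.prob w = μ.prob (w.rtake H ++ [a]) / μ.prob (w.rtake H) := by
  rcases le_total w.length H with hw | hw
  · rw [rtake_of_length_le hw]
  · obtain ⟨v, hv⟩ := exists_append_rtake w H
    have hl : (w.rtake H).length = H := by rw [length_rtake]; omega
    have := prob_append_mul_of_hasMemory hpos hμ v (w.rtake H) a (by omega)
    rw [← hv] at this
    rw [div_eq_div_iff (hpos _).ne' (hpos _).ne', this]
    ring

theorem law_eq_seqCode {μ : StationarySource A} (hpos : ∀ w, 0 < μ.prob w) {h : ℕ}
    (hμ : μ.HasMemory h) {n : ℕ} (x : Fin n → A) :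
    μ.law x = seqCode (fun w a => μ.prob (w.rtake h ++ [a]) / μ.prob (w.rtake h)) x := by
  induction n with
  | zero => simp [StationarySource.law, seqCode, μ.prob_nil]
  | succ n ih =>
    rw [← Fin.snoc_init_self x, seqCode_snoc, law_snoc, ← ih,
      ← prob_concat_div hpos hμ le_rfl, StationarySource.law]
    field_simp [(hpos _).ne']

end Source

/-! ### Redundancy -/

theorem sub_div_log_two_le {p q : ℝ} (hp : 0 < p) (hq : 0 < q) :
    (p - q) / Real.log 2 ≤ p * Real.logb 2 (p / q) := by
  have h2 : 0 < Real.log 2 := Real.log_pos one_lt_two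
  rw [Real.logb, ← mul_div_assoc, div_le_div_iff_of_pos_right h2]
  have h := Real.log_le_sub_one_of_pos (div_pos hq hp)
  rw [← inv_div, Real.log_inv] at *
  have := mul_le_mul_of_nonneg_left h hp.le
  rw [inv_div, mul_sub, mul_div_cancel₀ _ hp.ne'] at this
  rw [← inv_div, Real.log_inv] at this
  linarith

theorem eq_of_mul_logb_div_eq {p q : ℝ} (hp : 0 < p) (hq : 0 < q)
    (h : p * Real.logb 2 (p / q) = (p - q) / Real.log 2) : p = q := by
  by_contra hne
  have h2 : 0 < Real.log 2 := Real.log_pos one_lt_two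
  have h1 : q / p ≠ 1 := by
    rw [Ne, div_eq_one_iff_eq hp.ne']
    exact fun h => hne h.symm
  have h3 := mul_lt_mul_of_pos_left (Real.log_lt_sub_one_of_pos (div_pos hq hp) h1) hp
  rw [mul_sub, mul_div_cancel₀ _ hp.ne', ← inv_div, Real.log_inv] at h3
  rw [Real.logb, ← mul_div_assoc, div_left_inj' h2.ne'] at h
  linarith

/-- Gibbs' inequality. -/
theorem sum_mul_logb_div_nonneg {ι : Type*} [Fintype ι] {p q : ι → ℝ} (hp : ∀ i, 0 < p i)
    (hq : ∀ i, 0 < q i) (h : ∑ i, q i ≤ ∑ i, p i) : 0 ≤ ∑ i, p i * Real.logb 2 (p i / q i) := by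
  have h2 : 0 < Real.log 2 := Real.log_pos one_lt_two
  calc (0 : ℝ) ≤ ∑ i, (p i - q i) / Real.log 2 := by
        rw [← Finset.sum_div, Finset.sum_sub_distrib]
        exact div_nonneg (by linarith) h2.le
    _ ≤ _ := Finset.sum_le_sum fun i _ => sub_div_log_two_le (hp i) (hq i)

/-- The equality case of Gibbs' inequality. -/
theorem eq_of_sum_mul_logb_div_eq_zero {ι : Type*} [Fintype ι] {p q : ι → ℝ} (hp : ∀ i, 0 < p i)
    (hq : ∀ i, 0 < q i) (h : ∑ i, q i ≤ ∑ i, p i) (h0 : ∑ i, p i * Real.logb 2 (p i / q i) = 0)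
    (i : ι) : p i = q i := by
  have h2 : 0 < Real.log 2 := Real.log_pos one_lt_two
  have h1 : ∀ i ∈ Finset.univ, 0 ≤ p i * Real.logb 2 (p i / q i) - (p i - q i) / Real.log 2 :=
    fun i _ => sub_nonneg.2 (sub_div_log_two_le (hp i) (hq i))
  have h3 : ∑ i, (p i * Real.logb 2 (p i / q i) - (p i - q i) / Real.log 2) = 0 := by
    refine le_antisymm ?_ (Finset.sum_nonneg h1)
    rw [Finset.sum_sub_distrib, h0, ← Finset.sum_div, Finset.sum_sub_distrib, zero_sub,
      neg_nonpos]
    exact div_nonneg (by linarith) h2.le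
  exact eq_of_mul_logb_div_eq (hp i) (hq i)
    (sub_eq_zero.1 ((Finset.sum_eq_zero_iff_of_nonneg h1).1 h3 i (Finset.mem_univ i)))

theorem entropy_nonneg {A : Type*} [Fintype A] (μ : StationarySource A) (n : ℕ) :
    0 ≤ entropy μ n := by
  refine Finset.sum_nonneg fun x _ => ?_
  rcases (law_nonneg μ x).eq_or_lt with h | h
  · simp [← h]
  · refine mul_nonneg h.le (Real.logb_nonneg one_lt_two ?_)
    rw [le_div_iff₀ h, one_mul, ← sum_law μ n]
    exact Finset.single_le_sum (fun y _ => law_nonneg μ y) (Finset.mem_univ x)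

theorem redundancy_eq {A : Type*} [Fintype A] {μ : StationarySource A}
    (hpos : ∀ w, 0 < μ.prob w) {n : ℕ} (l : (Fin n → A) → ℝ) :
    redundancy μ l = ∑ x, μ.law x * Real.logb 2 (μ.law x / 2 ^ (-l x)) := by
  rw [redundancy, entropy, expect, expect, ← Finset.sum_sub_distrib]
  refine Finset.sum_congr rfl fun x _ => ?_
  have h1 : μ.law x ≠ 0 := (hpos _).ne'
  rw [Real.logb_div h1 (by positivity), Real.logb_rpow two_pos (by norm_num), one_div,
    Real.logb_inv]
  ring

theorem redundancy_nonneg {A : Type*} [Fintype A] {μ : StationarySource A}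
    (hpos : ∀ w, 0 < μ.prob w) {n : ℕ} {l : (Fin n → A) → ℝ} (hl : IsLengthFunction l) :
    0 ≤ redundancy μ l := by
  rw [redundancy_eq hpos]
  refine sum_mul_logb_div_nonneg (fun x => hpos _) (fun x => by positivity) ?_
  rw [sum_law]
  exact hl

/-- The type of a word: how often each symbol follows each of the contexts of depth `h`. Contexts at
the start of the word are shorter, and a context is encoded together with the symbol that follows
it, so that the type is indexed by the words of length at most `h + 1`. -/
noncomputable def markovType {A : Type*} [Fintype A] (h : ℕ) {n : ℕ} (x : Fin n → A) :
    shortWords A (h + 1) → Fin (n + 1) := by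
  classical
  exact fun k => ⟨(Finset.univ.filter fun t : Fin n => context h x t ++ [x t] = k).card,
    Nat.lt_succ_of_le ((Finset.card_le_univ _).trans (by simp))⟩

theorem law_eq_of_markovType_eq {A : Type*} [Fintype A] {μ : StationarySource A}
    (hpos : ∀ w, 0 < μ.prob w) {h : ℕ} (hμ : μ.HasMemory h) {n : ℕ} {x y : Fin n → A}
    (hxy : markovType h x = markovType h y) : μ.law x = μ.law y := by
  classical
  -- The law is a product of conditional probabilities; the type collects equal factors.
  have key : ∀ x : Fin n → A, μ.law x = ∏ k : shortWords A (h + 1),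
      (μ.prob k / μ.prob (k : List A).dropLast) ^ (markovType h x k : ℕ) := by
    intro x
    rw [law_eq_seqCode hpos hμ, seqCode]
    have h1 : ∀ t : Fin n, context h x t ++ [x t] ∈ shortWords A (h + 1) := by
      intro t
      rw [mem_shortWords, context_eq_rtake]
      simp [length_rtake]
    have h2 : ∏ k : shortWords A (h + 1),
          (μ.prob k / μ.prob (k : List A).dropLast) ^ (markovType h x k : ℕ)
        = ∏ k ∈ shortWords A (h + 1), (μ.prob k / μ.prob k.dropLast) ^
          (Finset.univ.filter fun t : Fin n => context h x t ++ [x t] = k).card :=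
      Finset.prod_coe_sort (shortWords A (h + 1)) fun k => (μ.prob k / μ.prob k.dropLast) ^
        (Finset.univ.filter fun t : Fin n => context h x t ++ [x t] = k).card
    rw [h2]
    simp only [← Finset.prod_const]
    rw [Finset.prod_fiberwise_of_maps_to' (fun t _ => h1 t)
      (fun k => μ.prob k / μ.prob k.dropLast)]
    refine Finset.prod_congr rfl fun t _ => ?_
    simp [context_eq_rtake]
  rw [key, key, hxy]

/-- The two-part code that describes the type of a word and then its index among the words of the
same type has redundancy at most the logarithm of the number of types. -/
theorem exists_lengthFunction_redundancy_le (A : Type*) [Fintype A] (h n : ℕ) :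
    ∃ l : (Fin n → A) → ℝ, IsLengthFunction l ∧
      ∀ μ : StationarySource A, (∀ w, 0 < μ.prob w) → μ.HasMemory h →
        redundancy μ l ≤ (shortWords A (h + 1)).card * Real.logb 2 (n + 1) := by
  classical
  let S : (Fin n → A) → Finset (Fin n → A) := fun x =>
    Finset.univ.filter fun y => markovType h y = markovType h x
  have hS : ∀ x, 0 < ((S x).card : ℝ) := fun x =>
    Nat.cast_pos.2 (Finset.card_pos.2 ⟨x, by simp [S]⟩)
  set k := (shortWords A (h + 1)).card with hk
  set M : ℝ := ((n : ℝ) + 1) ^ k with hM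
  have hMpos : 0 < M := by positivity
  have hcard : (Fintype.card (shortWords A (h + 1) → Fin (n + 1)) : ℝ) = M := by
    simp [hM, hk]
  refine ⟨fun x => Real.logb 2 (M * (S x).card), ?_, fun μ hpos hμ => ?_⟩
  -- Kraft's inequality: within a type the reciprocals of its size add up to one.
  · have h1 : ∀ x : Fin n → A, (2 : ℝ) ^ (-Real.logb 2 (M * (S x).card))
        = M⁻¹ * ((S x).card : ℝ)⁻¹ := by
      intro x
      rw [Real.rpow_neg two_pos.le, Real.rpow_logb two_pos (by norm_num)
        (mul_pos hMpos (hS x)), mul_inv]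
    rw [IsLengthFunction]
    simp only [h1]
    rw [← Finset.mul_sum, inv_mul_le_iff₀ hMpos, mul_one,
      ← Finset.sum_fiberwise (s := Finset.univ) (g := markovType h), ← hcard]
    have : (Fintype.card (shortWords A (h + 1) → Fin (n + 1)) : ℝ)
        = ∑ _τ : shortWords A (h + 1) → Fin (n + 1), (1 : ℝ) := by simp
    rw [this]
    refine Finset.sum_le_sum fun τ _ => ?_
    have h2 : ∀ x ∈ Finset.univ.filter (fun x : Fin n → A => markovType h x = τ),
        ((S x).card : ℝ)⁻¹
          = ((Finset.univ.filter (fun x : Fin n → A => markovType h x = τ)).card : ℝ)⁻¹ := by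
      intro x hx
      rw [Finset.mem_filter] at hx
      simp only [S, hx.2]
    rw [Finset.sum_congr rfl h2, Finset.sum_const, nsmul_eq_mul]
    exact mul_inv_le_one
  · have h3 : (k : ℝ) * Real.logb 2 (n + 1) = ∑ x : Fin n → A, μ.law x * Real.logb 2 M := by
      rw [← Finset.sum_mul, sum_law, one_mul, hM, Real.logb_pow]
    rw [h3, redundancy_eq hpos]
    refine Finset.sum_le_sum fun x _ => mul_le_mul_of_nonneg_left ?_ (law_nonneg μ x)
    have hx : 0 < μ.law x := hpos _
    refine Real.logb_le_logb_of_le one_lt_two (by positivity) ?_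
    rw [Real.rpow_neg two_pos.le, Real.rpow_logb two_pos (by norm_num)
      (mul_pos hMpos (hS x)), div_inv_eq_mul]
    -- All words of a type are equally likely, so that none of them is likelier than `1 / |S x|`.
    have h4 : μ.law x * (S x).card ≤ 1 := by
      rw [← sum_law μ n]
      calc μ.law x * (S x).card = ∑ y ∈ S x, μ.law y := by
            rw [Finset.sum_congr rfl (fun y hy => law_eq_of_markovType_eq hpos hμ
              (Finset.mem_filter.1 hy).2), Finset.sum_const, nsmul_eq_mul, mul_comm]
        _ ≤ _ := Finset.sum_le_sum_of_subset_of_nonneg (Finset.subset_univ _)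
            fun y _ _ => law_nonneg μ y
    nlinarith

namespace ParametricFamily

variable {A : Type*} [Fintype A] {d h : ℕ} (F : ParametricFamily A d h)

theorem iSup_redundancy_nonneg {n : ℕ} (l : {l : (Fin n → A) → ℝ // IsLengthFunction l}) :
    0 ≤ ⨆ θ : F.Θ, redundancy (F.source θ) l.1 :=
  Real.iSup_nonneg fun θ => redundancy_nonneg (F.pos θ θ.2) l.2

theorem minimaxRedundancy_nonneg (n : ℕ) : 0 ≤ F.minimaxRedundancy n :=
  Real.iInf_nonneg F.iSup_redundancy_nonneg

theorem minimaxRedundancy_le (n : ℕ) :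
    F.minimaxRedundancy n ≤ (shortWords A (h + 1)).card * Real.logb 2 (n + 1) := by
  obtain ⟨l, hl, hr⟩ := exists_lengthFunction_redundancy_le A h n
  refine (ciInf_le ⟨0, ?_⟩ ⟨l, hl⟩).trans (Real.iSup_le (fun θ =>
    hr _ (F.pos θ θ.2) (F.memory θ θ.2)) ?_)
  · rintro _ ⟨l, rfl⟩
    exact F.iSup_redundancy_nonneg l
  · exact mul_nonneg (Nat.cast_nonneg _) (Real.logb_nonneg one_lt_two (by simp))

theorem tendsto_minimaxRedundancy_div :
    Tendsto (fun n : ℕ => F.minimaxRedundancy n / n) atTop (𝓝 0) := by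
  have h1 : Tendsto (fun n : ℕ => Real.log ((n : ℝ) + 1) / ((n : ℝ) + 1)) atTop (𝓝 0) := by
    have := (Real.isLittleO_log_id_atTop.tendsto_div_nhds_zero).comp
      (tendsto_natCast_atTop_atTop (R := ℝ) |>.comp (tendsto_add_atTop_nat 1))
    refine this.congr fun n => ?_
    simp
  have h2 : Tendsto (fun n : ℕ => (shortWords A (h + 1)).card * 2 / Real.log 2 *
      (Real.log ((n : ℝ) + 1) / ((n : ℝ) + 1))) atTop (𝓝 0) := by
    simpa using h1.const_mul ((shortWords A (h + 1)).card * 2 / Real.log 2)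
  refine squeeze_zero' (Eventually.of_forall fun n =>
    div_nonneg (F.minimaxRedundancy_nonneg n) (Nat.cast_nonneg n)) ?_ h2
  filter_upwards [eventually_ge_atTop 1] with n hn
  have hn1 : (1 : ℝ) ≤ n := by exact_mod_cast hn
  have h3 := F.minimaxRedundancy_le n
  have hl2 : 0 < Real.log 2 := Real.log_pos one_lt_two
  have hlog : 0 ≤ Real.log ((n : ℝ) + 1) := Real.log_nonneg (by linarith)
  have hk : (0 : ℝ) ≤ (shortWords A (h + 1)).card := Nat.cast_nonneg _
  calc F.minimaxRedundancy n / n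
      ≤ (shortWords A (h + 1)).card * Real.logb 2 (n + 1) / n := by gcongr
    _ = (shortWords A (h + 1)).card / Real.log 2 * Real.log ((n : ℝ) + 1) * (1 / n) := by
        rw [Real.logb]; ring
    _ ≤ (shortWords A (h + 1)).card / Real.log 2 * Real.log ((n : ℝ) + 1) *
          (2 / ((n : ℝ) + 1)) := by
        refine mul_le_mul_of_nonneg_left ?_ (by positivity)
        rw [div_le_div_iff₀ (by linarith) (by linarith)]
        linarith
    _ = _ := by ring

end ParametricFamily

/-! ### The divergence rate of a tree measure -/

section Divergence

variable {A : Type*} [Fintype A]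

theorem divergence_seqCode_succ {μ : StationarySource A} (hpos : ∀ w, 0 < μ.prob w)
    {q : List A → A → ℝ} (hq : ∀ w a, 0 < q w a) (n : ℕ) :
    divergence μ (seqCode q (n := n + 1)) = divergence μ (seqCode q (n := n)) +
      ∑ x : Fin n → A, ∑ a, μ.prob (List.ofFn x ++ [a]) *
        Real.logb 2 (μ.prob (List.ofFn x ++ [a]) / (μ.law x * q (List.ofFn x) a)) := by
  rw [divergence, divergence, expect, expect, sum_fin_snoc, ← Finset.sum_add_distrib]
  refine Finset.sum_congr rfl fun x _ => ?_
  have hx : μ.law x ≠ 0 := (hpos _).ne'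
  have hs := (seqCode_pos hq x).ne'
  have h1 : μ.law x = ∑ a, μ.prob (List.ofFn x ++ [a]) := (μ.sum_append _).symm
  rw [show μ.law x * Real.logb 2 (μ.law x / seqCode q x)
    = ∑ a, μ.prob (List.ofFn x ++ [a]) * Real.logb 2 (μ.law x / seqCode q x) by
      rw [← Finset.sum_mul, ← h1], ← Finset.sum_add_distrib]
  refine Finset.sum_congr rfl fun a _ => ?_
  have ha := (hpos (List.ofFn x ++ [a])).ne'
  have hqa := (hq (List.ofFn x) a).ne'
  rw [law_snoc, seqCode_snoc, ← mul_add, Real.logb_div ha (mul_ne_zero hs hqa),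
    Real.logb_div hx hs, Real.logb_div ha (mul_ne_zero hx hqa), Real.logb_mul hs hqa,
    Real.logb_mul hx hqa]
  ring

/-- The divergence (in bits) of the conditional law of a symbol given its `H` predecessors from the
conditional probabilities `q`. -/
noncomputable def condDivergence (μ : StationarySource A) (q : List A → A → ℝ) (H : ℕ) : ℝ :=
  ∑ u : Fin H → A, ∑ a, μ.prob (List.ofFn u ++ [a]) *
    Real.logb 2 (μ.prob (List.ofFn u ++ [a]) / (μ.law u * q (List.ofFn u) a))

/-- Once the number of symbols exceeds all memories involved, the divergence grows by the same
amount with every further symbol. -/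
theorem divergence_seqCode_eq {μ : StationarySource A} (hpos : ∀ w, 0 < μ.prob w) {h : ℕ}
    (hμ : μ.HasMemory h) {q : List A → A → ℝ} (hq : ∀ w a, 0 < q w a) {H : ℕ} (hH : h ≤ H)
    (hqH : ∀ w a, q (w.rtake H) a = q w a) {n : ℕ} (hn : H ≤ n) :
    divergence μ (seqCode q (n := n)) = divergence μ (seqCode q (n := H)) +
      (n - H) * condDivergence μ q H := by
  induction n, hn using Nat.le_induction with
  | base => simp
  | succ n hn ih =>
    rw [divergence_seqCode_succ hpos hq, ih]
    -- The expected increment is a function of the last `H` symbols.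
    have key : ∀ (k : ℕ) (x : Fin k → A), ∑ a, μ.prob (List.ofFn x ++ [a]) *
          Real.logb 2 (μ.prob (List.ofFn x ++ [a]) / (μ.law x * q (List.ofFn x) a))
        = μ.prob (List.ofFn x) * (fun w => ∑ a, μ.prob (w ++ [a]) / μ.prob w *
          Real.logb 2 (μ.prob (w ++ [a]) / μ.prob w / q w a)) ((List.ofFn x).rtake H) := by
      intro k x
      simp only [Finset.mul_sum]
      refine Finset.sum_congr rfl fun a _ => ?_
      rw [← prob_concat_div hpos hμ hH, hqH, ← mul_assoc, mul_div_cancel₀ _ (hpos _).ne',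
        div_div, StationarySource.law]
    have h1 := sum_mul_rtake μ.sum_cons (fun w => ∑ a, μ.prob (w ++ [a]) / μ.prob w *
          Real.logb 2 (μ.prob (w ++ [a]) / μ.prob w / q w a)) hn
    have h2 := sum_mul_rtake μ.sum_cons (fun w => ∑ a, μ.prob (w ++ [a]) / μ.prob w *
          Real.logb 2 (μ.prob (w ++ [a]) / μ.prob w / q w a)) (le_refl H)
    rw [Finset.sum_congr rfl fun x _ => key n x, h1, ← h2,
      ← Finset.sum_congr rfl fun x _ => key H x, ← condDivergence]
    push_cast
    ring

theorem condDivergence_eq_sum (μ : StationarySource A) (q : List A → A → ℝ) (H : ℕ) :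
    condDivergence μ q H = ∑ z : (Fin H → A) × A, μ.prob (List.ofFn z.1 ++ [z.2]) *
      Real.logb 2 (μ.prob (List.ofFn z.1 ++ [z.2]) / (μ.law z.1 * q (List.ofFn z.1) z.2)) := by
  rw [Fintype.sum_prod_type]
  rfl

theorem sum_law_mul_le {μ : StationarySource A} {q : List A → A → ℝ}
    (hq1 : ∀ w, ∑ a, q w a = 1) (H : ℕ) :
    ∑ z : (Fin H → A) × A, μ.law z.1 * q (List.ofFn z.1) z.2
      ≤ ∑ z : (Fin H → A) × A, μ.prob (List.ofFn z.1 ++ [z.2]) := by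
  rw [Fintype.sum_prod_type, Fintype.sum_prod_type]
  refine Finset.sum_le_sum fun x _ => ?_
  simp [← Finset.mul_sum, hq1, μ.sum_append, StationarySource.law]

theorem condDivergence_nonneg {μ : StationarySource A} (hpos : ∀ w, 0 < μ.prob w)
    {q : List A → A → ℝ} (hq : ∀ w a, 0 < q w a) (hq1 : ∀ w, ∑ a, q w a = 1) (H : ℕ) :
    0 ≤ condDivergence μ q H := by
  rw [condDivergence_eq_sum]
  exact sum_mul_logb_div_nonneg (fun z => hpos _) (fun z => mul_pos (hpos _) (hq _ _))
    (sum_law_mul_le hq1 H)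

theorem eq_of_condDivergence_eq_zero {μ : StationarySource A} (hpos : ∀ w, 0 < μ.prob w)
    {q : List A → A → ℝ} (hq : ∀ w a, 0 < q w a) (hq1 : ∀ w, ∑ a, q w a = 1) {H : ℕ}
    (h0 : condDivergence μ q H = 0) (u : Fin H → A) (a : A) :
    μ.prob (List.ofFn u ++ [a]) = μ.law u * q (List.ofFn u) a := by
  rw [condDivergence_eq_sum] at h0
  exact eq_of_sum_mul_logb_div_eq_zero (fun z => hpos _) (fun z => mul_pos (hpos _) (hq _ _))
    (sum_law_mul_le hq1 H) h0 (u, a)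

end Divergence

/-! ### Sources are determined by their conditional probabilities -/

section Unique

variable {A : Type*} [Fintype A]

theorem nonempty_alphabet (μ : StationarySource A) : Nonempty A := by
  by_contra h
  rw [not_nonempty_iff] at h
  have := μ.sum_append []
  rw [μ.prob_nil] at this
  simp at this

/-- Two stationary sources with the same positive conditional probabilities given the last `D`
symbols are equal. If `M` is the largest ratio `μ s / ν s` of word probabilities for words of length
`D`, the function `M ν - μ` is additive and nonnegative on the words of length `D` and vanishes on
one of them; since every word can be followed by that one, it vanishes everywhere. -/
theorem eq_of_prob_concat {μ ν : StationarySource A} (hν : ∀ w, 0 < ν.prob w) {D : ℕ}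
    {f : List A → A → ℝ} (hf : ∀ s a, 0 < f s a)
    (h1 : ∀ w a, D ≤ w.length → μ.prob (w ++ [a]) = μ.prob w * f (w.rtake D) a)
    (h2 : ∀ w a, D ≤ w.length → ν.prob (w ++ [a]) = ν.prob w * f (w.rtake D) a) : μ = ν := by
  have := nonempty_alphabet μ
  obtain ⟨s, hs⟩ := Finite.exists_max fun u : Fin D → A => μ.law u / ν.law u
  set M := μ.law s / ν.law s with hM
  let g : List A → ℝ := fun w => M * ν.prob w - μ.prob w
  have hg : ∀ w, ∑ a, g (a :: w) = g w := fun w => by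
    simp only [g, Finset.sum_sub_distrib, ← Finset.mul_sum, μ.sum_cons, ν.sum_cons]
  have hg1 : ∀ w a, D ≤ w.length → g (w ++ [a]) = g w * f (w.rtake D) a := fun w a hw => by
    simp only [g, h1 w a hw, h2 w a hw]
    ring
  have hg2 : ∀ v w, D ≤ w.length → ∃ c : ℝ, 0 < c ∧ g (w ++ v) = g w * c := by
    intro v
    induction v with
    | nil => exact fun w _ => ⟨1, one_pos, by simp⟩
    | cons a v ih =>
      intro w hw
      obtain ⟨c, hc, hcw⟩ := ih (w ++ [a]) (by simp; omega)
      refine ⟨f (w.rtake D) a * c, mul_pos (hf _ _) hc, ?_⟩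
      rw [← mul_assoc, ← hg1 w a hw, ← hcw]
      simp
  have hg3 : ∀ u : Fin D → A, 0 ≤ g (List.ofFn u) := fun u => by
    have := hs u
    have h3 : 0 < ν.law u := hν _
    rw [div_le_iff₀ h3] at this
    exact sub_nonneg.2 this
  have hgs : g (List.ofFn s) = 0 := by
    have h3 : ν.law s ≠ 0 := (hν _).ne'
    change M * ν.law s - μ.law s = 0
    rw [hM, div_mul_cancel₀ _ h3, sub_self]
  have hg4 : ∀ u : Fin D → A, g (List.ofFn u) = 0 := by
    have h3 := sum_ofFn_append hg D (List.ofFn s)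
    have h4 : ∀ u ∈ Finset.univ, 0 ≤ g (List.ofFn (n := D) u ++ List.ofFn s) := fun u _ => by
      obtain ⟨c, hc, hcu⟩ := hg2 (List.ofFn s) (List.ofFn u) (by simp)
      rw [hcu]
      exact mul_nonneg (hg3 u) hc.le
    rw [hgs, Finset.sum_eq_zero_iff_of_nonneg h4] at h3
    intro u
    obtain ⟨c, hc, hcu⟩ := hg2 (List.ofFn s) (List.ofFn u) (by simp)
    have h5 := h3 u (Finset.mem_univ u)
    rw [hcu] at h5
    exact (mul_eq_zero.1 h5).resolve_right hc.ne'
  have hg5 : ∀ v, g v = 0 := by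
    intro v
    rw [← sum_ofFn_append hg D v]
    refine Finset.sum_eq_zero fun u _ => ?_
    obtain ⟨c, hc, hcu⟩ := hg2 v (List.ofFn u) (by simp)
    rw [hcu, hg4, zero_mul]
  have hM1 : M = 1 := by
    have := hg5 []
    simp only [g, μ.prob_nil, ν.prob_nil] at this
    linarith
  refine StationarySource.ext_prob fun w => ?_
  have := hg5 w
  simp only [g, hM1] at this
  linarith

/-- If a source of memory at most `h` has, on all words of length `H`, the conditional probabilities
that its mixture `c μ + R` with a word function `R` has given the last `D` symbols, then they are
the conditional probabilities of `R`. -/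
theorem prob_concat_of_mixture {μ : StationarySource A} (hμ : ∀ w, 0 < μ.prob w) {h D H : ℕ}
    (hm : μ.HasMemory h) (hh : h ≤ H) (hD : D ≤ H) {R : List A → ℝ} (hR : ∀ w, 0 < R w)
    {c : ℝ} (hc : 0 < c)
    (he : ∀ w a, w.length = H → μ.prob (w ++ [a]) * (c * μ.prob (w.rtake D) + R (w.rtake D))
      = μ.prob w * (c * μ.prob (w.rtake D ++ [a]) + R (w.rtake D ++ [a])))
    (w : List A) (a : A) (hw : D ≤ w.length) :
    μ.prob (w ++ [a]) = μ.prob w * (R (w.rtake D ++ [a]) / R (w.rtake D)) := by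
  -- Shorter words than `H` are treated by summing over prefixes, longer ones by the memory of `μ`.
  have h1 : ∀ w a, D ≤ w.length →
      μ.prob (w ++ [a]) * (c * μ.prob (w.rtake D) + R (w.rtake D))
        = μ.prob w * (c * μ.prob (w.rtake D ++ [a]) + R (w.rtake D ++ [a])) := by
    intro w a hw
    rcases le_total w.length H with hwH | hwH
    · rw [← sum_ofFn_append μ.sum_cons (H - w.length) w,
        ← sum_ofFn_append μ.sum_cons (H - w.length) (w ++ [a]), Finset.sum_mul, Finset.sum_mul]
      refine Finset.sum_congr rfl fun v _ => ?_
      have h2 : (List.ofFn v ++ w).rtake D = w.rtake D := by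
        rw [← rtake_rtake _ hw, rtake_append_of_length]
      have := he (List.ofFn v ++ w) a (by simp; omega)
      rwa [h2, List.append_assoc] at this
    · obtain ⟨v, hv⟩ := exists_append_rtake w H
      have hl : (w.rtake H).length = H := by rw [length_rtake]; omega
      have h2 := prob_append_mul_of_hasMemory hμ hm v (w.rtake H) a (by omega)
      have h3 := he (w.rtake H) a hl
      rw [← hv] at h2
      rw [rtake_rtake _ hD] at h3
      refine mul_right_cancel₀ (hμ (w.rtake H)).ne' ?_
      linear_combination (c * μ.prob (w.rtake D) + R (w.rtake D)) * h2 + μ.prob w * h3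
  have hl : (w.rtake D).length = D := by rw [length_rtake]; omega
  have h2 := h1 (w.rtake D) a hl.ge
  rw [rtake_rtake _ le_rfl] at h2
  have h3 := h1 w a hw
  have hRw := hR (w.rtake D)
  have hmw : 0 < c * μ.prob (w.rtake D) + R (w.rtake D) := by
    have := hμ (w.rtake D)
    positivity
  rw [← mul_div_assoc, eq_div_iff hRw.ne']
  refine mul_right_cancel₀ hmw.ne' ?_
  have h4 : μ.prob (w.rtake D ++ [a]) * R (w.rtake D)
      = μ.prob (w.rtake D) * R (w.rtake D ++ [a]) := by linear_combination h2
  linear_combination R (w.rtake D) * h3 + μ.prob w * c * h4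

end Unique

/-! ### The tree measure of a mixture -/

section Mixture

/-- The conditional probabilities of the next symbol given the last `D` symbols that belong to the
word function `m`. -/
noncomputable def treeCond {A : Type*} (m : List A → ℝ) (D : ℕ) (w : List A) (a : A) : ℝ :=
  m (w.rtake D ++ [a]) / m (w.rtake D)

theorem treeCond_pos {A : Type*} {m : List A → ℝ} (hm : ∀ w, 0 < m w) (D : ℕ) (w : List A) (a : A) :
    0 < treeCond m D w a :=
  div_pos (hm _) (hm _)

variable {A : Type*} [Fintype A] {d h : ℕ} (F : ParametricFamily A d h) {K : ℕ} (p : Fin K → ℝ)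
  (θ : Fin K → Fin d → ℝ)

theorem treeMixture_eq_seqCode (D n : ℕ) :
    treeMixture F p θ D n = seqCode (treeCond (mixtureProb F p θ) D) := by
  funext x
  simp only [treeMixture, seqCode, treeCond, context_eq_rtake]

theorem mixtureProb_append (w : List A) :
    ∑ a, mixtureProb F p θ (w ++ [a]) = mixtureProb F p θ w := by
  simp only [mixtureProb]
  rw [Finset.sum_comm]
  simp only [← Finset.mul_sum, StationarySource.sum_append]

theorem mixtureProb_cons (w : List A) :
    ∑ a, mixtureProb F p θ (a :: w) = mixtureProb F p θ w := by
  simp only [mixtureProb]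
  rw [Finset.sum_comm]
  simp only [← Finset.mul_sum, StationarySource.sum_cons]

variable {F p θ}

theorem mixtureProb_nil (hp1 : ∑ i, p i = 1) : mixtureProb F p θ [] = 1 := by
  simp [mixtureProb, StationarySource.prob_nil, hp1]

theorem mixtureProb_pos (hK : 2 ≤ K) (hp : ∀ i, 0 < p i) (hθ : ∀ i, θ i ∈ F.Θ) (w : List A) :
    0 < mixtureProb F p θ w :=
  Finset.sum_pos (fun i _ => mul_pos (hp i) (F.pos _ (hθ i) w)) ⟨⟨0, by omega⟩, Finset.mem_univ _⟩

theorem sum_treeCond {m : List A → ℝ} (hm : ∀ w, 0 < m w)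
    (hs : ∀ w, ∑ a, m (w ++ [a]) = m w) (D : ℕ) (w : List A) : ∑ a, treeCond m D w a = 1 := by
  simp only [treeCond]
  rw [← Finset.sum_div, hs, div_self (hm _).ne']

end Mixture

/-! ### Jeffreys' prior -/

namespace ParametricFamily

variable {A : Type*} [Fintype A] {d h : ℕ} (F : ParametricFamily A d h)

theorem jeffreys_absolutelyContinuous :
    F.jeffreys ≪ volume.restrict F.Θ :=
  Measure.AbsolutelyContinuous.trans
    (Measure.smul_absolutelyContinuous) (withDensity_absolutelyContinuous _ _)

theorem isProbabilityMeasure_jeffreys (hJ : F.jeffreysMass ≠ 0) (hJ' : F.jeffreysMass ≠ ⊤) :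
    IsProbabilityMeasure F.jeffreys := by
  constructor
  rw [jeffreys, Measure.smul_apply, withDensity_apply _ MeasurableSet.univ,
    Measure.restrict_univ, smul_eq_mul]
  exact ENNReal.inv_mul_cancel hJ hJ'

end ParametricFamily

/-- A measurable set of a product space is null if it meets each line in the `i`-th coordinate
direction in at most one point. -/
theorem pi_eq_zero_of_fibers {ι X : Type*} [Fintype ι] [MeasurableSpace X] (μ : Measure X)
    [SigmaFinite μ] [NullSingletonClass μ] {B : Set (ι → X)} (hB : MeasurableSet B) (i : ι)
    (h : ∀ x ∈ B, ∀ y ∈ B, (∀ j, j ≠ i → x j = y j) → x = y) :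
    Measure.pi (fun _ : ι => μ) B = 0 := by
  classical
  rw [← lintegral_indicator_one hB, ← lintegral_zero (μ := Measure.pi fun _ : ι => μ)]
  refine lintegral_eq_of_lmarginal_eq {i} (measurable_one.indicator hB) measurable_const ?_
  funext x
  rw [lmarginal_singleton, lmarginal_singleton]
  change ∫⁻ t, ((fun t => Function.update x i t) ⁻¹' B).indicator 1 t ∂μ = ∫⁻ _, 0 ∂μ
  rw [lintegral_indicator_one (hB.preimage (measurable_update x)), lintegral_zero]
  refine Set.Subsingleton.measure_zero (fun s hs t ht => ?_) _
  have := congrFun (h _ hs _ ht fun j hj => by simp [hj]) i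
  simpa using this

namespace ParametricFamily

variable {A : Type*} [Fintype A] {d h : ℕ} (F : ParametricFamily A d h)

theorem nullSingletonClass_jeffreys (hd : 1 ≤ d) : NullSingletonClass F.jeffreys := by
  have : Nonempty (Fin d) := ⟨⟨0, hd⟩⟩
  exact ⟨fun x => F.jeffreys_absolutelyContinuous (measure_singleton x)⟩

theorem ae_mem_jeffreys : ∀ᵐ τ ∂F.jeffreys, τ ∈ F.Θ :=
  F.jeffreys_absolutelyContinuous.ae_le (ae_restrict_mem F.isOpen.measurableSet)

theorem measurable_indicator_prob (w : List A) :
    Measurable (F.Θ.indicator fun τ => (F.source τ).prob w) := by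
  classical
  rw [← Set.piecewise_eq_indicator]
  exact (F.smooth w).continuousOn.measurable_piecewise continuousOn_const
    F.isOpen.measurableSet

variable {K : ℕ}

theorem isProbabilityMeasure_prior (hJ : F.jeffreysMass ≠ 0) (hJ' : F.jeffreysMass ≠ ⊤) :
    IsProbabilityMeasure (F.prior K) := by
  have := F.isProbabilityMeasure_jeffreys hJ hJ'
  exact inferInstanceAs (IsProbabilityMeasure (Measure.pi fun _ => F.jeffreys))

theorem ae_mem_prior (hJ : F.jeffreysMass ≠ 0) (hJ' : F.jeffreysMass ≠ ⊤) :
    ∀ᵐ θ ∂F.prior K, ∀ i, θ i ∈ F.Θ := by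
  have := F.isProbabilityMeasure_jeffreys hJ hJ'
  exact eventually_all.2 fun i =>
    (Measure.quasiMeasurePreserving_eval (fun _ : Fin K => F.jeffreys) i).ae F.ae_mem_jeffreys

theorem aemeasurable_prob_prior (hJ : F.jeffreysMass ≠ 0) (hJ' : F.jeffreysMass ≠ ⊤) (i : Fin K)
    (w : List A) : AEMeasurable (fun θ => (F.source (θ i)).prob w) (F.prior K) := by
  refine ⟨fun θ => F.Θ.indicator (fun τ => (F.source τ).prob w) (θ i),
    (F.measurable_indicator_prob w).comp (measurable_pi_apply i), ?_⟩
  filter_upwards [F.ae_mem_prior hJ hJ'] with θ hθ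
  rw [Set.indicator_of_mem (hθ i)]

/-- A component of a mixture whose conditional probabilities are those of the mixture given the last
`D` symbols is determined by the other components. -/
theorem eq_of_mixture_eq {K : ℕ} (hK : 2 ≤ K) {p : Fin K → ℝ} (hp : ∀ i, 0 < p i) {D H : ℕ}
    (hh : h ≤ H) (hD : D ≤ H) (i : Fin K) {x y : Fin K → Fin d → ℝ} (hx : ∀ j, x j ∈ F.Θ)
    (hy : ∀ j, y j ∈ F.Θ) (hxy : ∀ j, j ≠ i → x j = y j)
    (hxm : ∀ w a, w.length = H → (F.source (x i)).prob (w ++ [a]) * mixtureProb F p x (w.rtake D)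
      = (F.source (x i)).prob w * mixtureProb F p x (w.rtake D ++ [a]))
    (hym : ∀ w a, w.length = H → (F.source (y i)).prob (w ++ [a]) * mixtureProb F p y (w.rtake D)
      = (F.source (y i)).prob w * mixtureProb F p y (w.rtake D ++ [a])) : x = y := by
  obtain ⟨R, hR⟩ : ∃ R : List A → ℝ,
      ∀ w, R w = ∑ j ∈ Finset.univ.erase i, p j * (F.source (x j)).prob w := ⟨_, fun _ => rfl⟩
  have hR0 : ∀ w, 0 < R w := by
    intro w
    rw [hR]
    refine Finset.sum_pos (fun j _ => mul_pos (hp j) (F.pos _ (hx j) w)) ?_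
    have : Nontrivial (Fin K) := Fin.nontrivial_iff_two_le.2 hK
    obtain ⟨j, hj⟩ := exists_ne i
    exact ⟨j, by simpa using hj⟩
  have hRx : ∀ w, mixtureProb F p x w = p i * (F.source (x i)).prob w + R w := fun w => by
    rw [mixtureProb, ← Finset.add_sum_erase _ _ (Finset.mem_univ i), hR]
  have hRy : ∀ w, mixtureProb F p y w = p i * (F.source (y i)).prob w + R w := fun w => by
    rw [mixtureProb, ← Finset.add_sum_erase _ _ (Finset.mem_univ i), hR]
    congr 1
    refine Finset.sum_congr rfl fun j hj => ?_
    rw [hxy j (Finset.ne_of_mem_erase hj)]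
  simp only [hRx] at hxm
  simp only [hRy] at hym
  have h1 := prob_concat_of_mixture (F.pos _ (hx i)) (F.memory _ (hx i)) hh hD hR0 (hp i) hxm
  have h2 := prob_concat_of_mixture (F.pos _ (hy i)) (F.memory _ (hy i)) hh hD hR0 (hp i) hym
  have h3 : F.source (x i) = F.source (y i) := eq_of_prob_concat (D := D)
    (f := fun s a => R (s ++ [a]) / R s) (F.pos _ (hy i))
    (fun s a => div_pos (hR0 _) (hR0 _)) h1 h2
  funext j
  by_cases hj : j = i
  · rw [hj]
    exact F.identifiable (hx i) (hy i) h3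
  · exact hxy j hj

/-- Almost surely, no source of the family agrees with the tree measure of the mixture: its
divergence rate from it is positive. Otherwise the source would be determined by the other
components of the mixture, so that its parameter vector, which has a density, would have to be
equal to a given vector. -/
theorem ae_condDivergence_pos (hd : 1 ≤ d) (hJ : F.jeffreysMass ≠ 0) (hJ' : F.jeffreysMass ≠ ⊤)
    (hK : 2 ≤ K) {p : Fin K → ℝ} (hp : ∀ i, 0 < p i) (D : ℕ) :
    ∀ᵐ θ ∂F.prior K, ∀ i,
      0 < condDivergence (F.source (θ i)) (treeCond (mixtureProb F p θ) D) (max h D) := by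
  have := F.isProbabilityMeasure_jeffreys hJ hJ'
  have := F.nullSingletonClass_jeffreys hd
  refine eventually_all.2 fun i => ?_
  have hhH := le_max_left h D
  have hDH := le_max_right h D
  generalize max h D = H at hhH hDH ⊢
  -- Outside `Θ` the word probabilities need not be measurable in the parameter.
  let P : List A → (Fin d → ℝ) → ℝ := fun w => F.Θ.indicator fun τ => (F.source τ).prob w
  have hP : ∀ w (j : Fin K), Measurable fun θ : Fin K → Fin d → ℝ => P w (θ j) := fun w j =>
    (F.measurable_indicator_prob w).comp (measurable_pi_apply j)
  let m : List A → (Fin K → Fin d → ℝ) → ℝ := fun w θ => ∑ j, p j * P w (θ j)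
  have hm : ∀ w, Measurable (m w) := fun w =>
    Finset.measurable_sum _ fun j _ => (hP w j).const_mul _
  have hPm : ∀ θ : Fin K → Fin d → ℝ, (∀ j, θ j ∈ F.Θ) →
      (∀ w j, P w (θ j) = (F.source (θ j)).prob w) ∧ ∀ w, m w θ = mixtureProb F p θ w := by
    intro θ hθ
    have h1 : ∀ w j, P w (θ j) = (F.source (θ j)).prob w := fun w j =>
      Set.indicator_of_mem (hθ j) _
    exact ⟨h1, fun w => by simp only [m, mixtureProb, h1]⟩
  let B : Set (Fin K → Fin d → ℝ) := {θ | ∀ j, θ j ∈ F.Θ} ∩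
    ⋂ (u : Fin H → A), ⋂ (a : A), {θ | P (List.ofFn u ++ [a]) (θ i) * m ((List.ofFn u).rtake D) θ
      = P (List.ofFn u) (θ i) * m ((List.ofFn u).rtake D ++ [a]) θ}
  have hB : MeasurableSet B := by
    refine MeasurableSet.inter ?_ (MeasurableSet.iInter fun u => MeasurableSet.iInter fun a => ?_)
    · rw [Set.ofPred_forall]
      exact MeasurableSet.iInter fun j => (measurable_pi_apply j) F.isOpen.measurableSet
    · exact measurableSet_eq_fun ((hP _ _).mul (hm _)) ((hP _ _).mul (hm _))
  have hBm : ∀ z ∈ B, (∀ j, z j ∈ F.Θ) ∧ ∀ w a, w.length = H →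
      (F.source (z i)).prob (w ++ [a]) * mixtureProb F p z (w.rtake D)
        = (F.source (z i)).prob w * mixtureProb F p z (w.rtake D ++ [a]) := by
    rintro z ⟨hz, hz'⟩
    refine ⟨hz, fun w a hw => ?_⟩
    subst hw
    have h1 := Set.mem_iInter.1 (Set.mem_iInter.1 hz' w.get) a
    rw [Set.mem_ofPred_eq, List.ofFn_get, (hPm z hz).1, (hPm z hz).1, (hPm z hz).2,
      (hPm z hz).2] at h1
    exact h1
  have hB0 : F.prior K B = 0 := by
    refine pi_eq_zero_of_fibers _ hB i fun x hx y hy hxy => ?_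
    obtain ⟨hx1, hx2⟩ := hBm x hx
    obtain ⟨hy1, hy2⟩ := hBm y hy
    exact F.eq_of_mixture_eq hK hp hhH hDH i hx1 hy1 hxy hx2 hy2
  filter_upwards [F.ae_mem_prior hJ hJ', measure_eq_zero_iff_ae_notMem.1 hB0] with θ hθ hθB
  have hmpos : ∀ w, 0 < mixtureProb F p θ w := mixtureProb_pos hK hp hθ
  have hq := treeCond_pos hmpos D
  have hq1 := sum_treeCond hmpos (mixtureProb_append F p θ) D
  refine (condDivergence_nonneg (F.pos _ (hθ i)) hq hq1 H).lt_of_ne fun h0 => hθB ⟨hθ, ?_⟩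
  refine Set.mem_iInter.2 fun u => Set.mem_iInter.2 fun a => ?_
  rw [Set.mem_ofPred_eq, (hPm θ hθ).1, (hPm θ hθ).1, (hPm θ hθ).2, (hPm θ hθ).2,
    eq_of_condDivergence_eq_zero (F.pos _ (hθ i)) hq hq1 h0.symm u a, treeCond, mul_assoc,
    div_mul_cancel₀ _ (hmpos _).ne', StationarySource.law]

end ParametricFamily

/-! ### Asymptotics of the main term -/

section Asymptotics

variable {A : Type*} [Fintype A] {d h : ℕ} {F : ParametricFamily A d h} {K : ℕ} {p : Fin K → ℝ}
  {θ : Fin K → Fin d → ℝ}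

theorem divergence_treeMixture_eq (hK : 2 ≤ K) (hp : ∀ i, 0 < p i) (hθ : ∀ i, θ i ∈ F.Θ)
    (D : ℕ) (i : Fin K) {n : ℕ} (hn : max h D ≤ n) :
    divergence (F.source (θ i)) (treeMixture F p θ D n) =
      divergence (F.source (θ i)) (treeMixture F p θ D (max h D)) + (n - (max h D : ℕ)) *
        condDivergence (F.source (θ i)) (treeCond (mixtureProb F p θ) D) (max h D) := by
  rw [treeMixture_eq_seqCode, treeMixture_eq_seqCode]
  refine divergence_seqCode_eq (F.pos _ (hθ i)) (F.memory _ (hθ i))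
    (treeCond_pos (mixtureProb_pos hK hp hθ) D) (le_max_left h D) (fun w a => ?_) hn
  rw [treeCond, treeCond, rtake_rtake _ (le_max_right h D)]

theorem tendsto_divergence_div (hK : 2 ≤ K) (hp : ∀ i, 0 < p i) (hθ : ∀ i, θ i ∈ F.Θ)
    (D : ℕ) (i : Fin K) :
    Tendsto (fun n : ℕ => divergence (F.source (θ i)) (treeMixture F p θ D n) / n) atTop
      (𝓝 (condDivergence (F.source (θ i)) (treeCond (mixtureProb F p θ) D) (max h D))) := by
  set k := condDivergence (F.source (θ i)) (treeCond (mixtureProb F p θ) D) (max h D)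
  set c := divergence (F.source (θ i)) (treeMixture F p θ D (max h D))
  have h1 : Tendsto (fun n : ℕ => (c - (max h D : ℕ) * k) / n + k) atTop (𝓝 (0 + k)) :=
    (tendsto_const_div_atTop_nhds_zero_nat _).add_const k
  rw [zero_add] at h1
  refine h1.congr' ?_
  filter_upwards [eventually_ge_atTop (max (max h D) 1)] with n hn
  have hn1 : (n : ℝ) ≠ 0 := by
    have : 1 ≤ n := (le_max_right _ _).trans hn
    positivity
  rw [divergence_treeMixture_eq hK hp hθ D i ((le_max_left _ _).trans hn)]
  field_simp
  ring

theorem isTheta_divergence (hK : 2 ≤ K) (hp : ∀ i, 0 < p i) (hθ : ∀ i, θ i ∈ F.Θ)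
    (D : ℕ) (i : Fin K)
    (hk : 0 < condDivergence (F.source (θ i)) (treeCond (mixtureProb F p θ) D) (max h D)) :
    (fun n : ℕ => divergence (F.source (θ i)) (treeMixture F p θ D n))
      =Θ[atTop] (fun n : ℕ => (n : ℝ)) := by
  have h1 := tendsto_divergence_div hK hp hθ D i
  exact (isTheta_of_div_tendsto_nhds_ne_zero h1 hk.ne').symm

/-- Entropy plus divergence is the expected length of the ideal code for `q`. -/
theorem entropy_add_divergence {μ : StationarySource A} (hpos : ∀ w, 0 < μ.prob w) {n : ℕ}
    {q : (Fin n → A) → ℝ} (hq : ∀ x, 0 < q x) :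
    entropy μ n + divergence μ q = ∑ x, μ.law x * Real.logb 2 (1 / q x) := by
  rw [entropy, divergence, expect, expect, ← Finset.sum_add_distrib]
  refine Finset.sum_congr rfl fun x _ => ?_
  have h1 : μ.law x ≠ 0 := (hpos _).ne'
  rw [Real.logb_div one_ne_zero h1, Real.logb_div h1 (hq x).ne',
    Real.logb_div one_ne_zero (hq x).ne']
  ring

end Asymptotics

section Bounds

theorem logb_one_div_seqCode {A : Type*} {q : List A → A → ℝ} (hq : ∀ w a, 0 < q w a) {n : ℕ}
    (x : Fin n → A) :
    Real.logb 2 (1 / seqCode q x)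
      = ∑ t : Fin n, Real.logb 2 (1 / q ((List.ofFn x).take t) (x t)) := by
  simp only [one_div, Real.logb_inv, Finset.sum_neg_distrib]
  rw [seqCode, Real.logb_prod _ _ fun t _ => (hq _ _).ne']

variable {A : Type*} [Fintype A]

theorem one_sub_le_logb_one_div {q : ℝ} (hq : 0 < q) (hq1 : q ≤ 1) :
    1 - q ≤ Real.logb 2 (1 / q) := by
  have h2 : 0 < Real.log 2 := Real.log_pos one_lt_two
  have h3 : Real.log 2 ≤ 1 := by linarith [Real.log_two_lt_d9]
  rw [one_div, Real.logb_inv, Real.logb, ← neg_div, le_div_iff₀ h2]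
  have := Real.log_le_sub_one_of_pos hq
  nlinarith

theorem lt_one_of_sum_eq_one [Nontrivial A] {q : A → ℝ} (hq : ∀ a, 0 < q a)
    (hq1 : ∑ a, q a = 1) (a : A) : q a < 1 := by
  obtain ⟨b, hb⟩ := exists_ne a
  rw [← hq1]
  exact Finset.single_lt_sum hb (Finset.mem_univ a) (Finset.mem_univ b) (hq b)
    fun c _ _ => (hq c).le

/-- A bound for the number of symbols per bit of expected code length of the tree measure with
conditional probabilities `q`. It is a crude one, a sum over all contexts and symbols instead of a
maximum, which is evidently measurable in the parameters. -/
noncomputable def symbolsPerBit (q : List A → A → ℝ) (D : ℕ) : ℝ :=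
  ∑ s ∈ shortWords A D, ∑ a, (1 - q s a)⁻¹

/-- The expected code length grows at least linearly, because every conditional probability `q s a`
is below one and there are only finitely many contexts `s`. -/
theorem le_symbolsPerBit_mul [Nontrivial A] {μ : StationarySource A} (hpos : ∀ w, 0 < μ.prob w)
    {q : List A → A → ℝ} (hq : ∀ w a, 0 < q w a) (hq1 : ∀ w, ∑ a, q w a = 1) {D : ℕ}
    (hqD : ∀ w a, q (w.rtake D) a = q w a) (n : ℕ) :
    (n : ℝ) ≤ symbolsPerBit q D * (entropy μ n + divergence μ (seqCode q (n := n))) := by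
  have hlt : ∀ w a, 0 < 1 - q w a := fun w a =>
    sub_pos.2 (lt_one_of_sum_eq_one (hq w) (hq1 w) a)
  have h0 : ∀ s ∈ shortWords A D, 0 ≤ ∑ a, (1 - q s a)⁻¹ := fun s _ =>
    Finset.sum_nonneg fun a _ => inv_nonneg.2 (hlt s a).le
  have hS : 0 ≤ symbolsPerBit q D := Finset.sum_nonneg h0
  have h1 : ∀ w a, 1 ≤ symbolsPerBit q D * Real.logb 2 (1 / q w a) := by
    intro w a
    have h2 : (1 - q w a)⁻¹ ≤ symbolsPerBit q D := by
      refine le_trans ?_ (Finset.single_le_sum h0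
        (mem_shortWords.2 ((length_rtake w D).le.trans (min_le_right _ _))))
      rw [← hqD]
      exact Finset.single_le_sum (f := fun a => (1 - q (w.rtake D) a)⁻¹)
        (fun a _ => inv_nonneg.2 (hlt _ a).le) (Finset.mem_univ a)
    have h3 := one_sub_le_logb_one_div (hq w a) (by linarith [hlt w a])
    calc (1 : ℝ) = (1 - q w a)⁻¹ * (1 - q w a) := (inv_mul_cancel₀ (hlt w a).ne').symm
      _ ≤ _ := mul_le_mul h2 h3 (hlt w a).le hS
  rw [entropy_add_divergence hpos (seqCode_pos hq), Finset.mul_sum]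
  calc (n : ℝ) = ∑ x : Fin n → A, μ.law x * n := by rw [← Finset.sum_mul, sum_law, one_mul]
    _ ≤ _ := by
        refine Finset.sum_le_sum fun x _ => ?_
        rw [mul_left_comm]
        refine mul_le_mul_of_nonneg_left ?_ (law_nonneg μ x)
        rw [logb_one_div_seqCode hq, Finset.mul_sum]
        calc (n : ℝ) = ∑ _t : Fin n, (1 : ℝ) := by simp
          _ ≤ _ := Finset.sum_le_sum fun t _ => h1 _ _

theorem exists_entropy_add_divergence_le {μ : StationarySource A}
    (hpos : ∀ w, 0 < μ.prob w) {q : List A → A → ℝ} (hq : ∀ w a, 0 < q w a)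
    (hq1 : ∀ w, ∑ a, q w a = 1) {D : ℕ} (hqD : ∀ w a, q (w.rtake D) a = q w a) :
    ∃ U : ℝ, ∀ n : ℕ, entropy μ n + divergence μ (seqCode q (n := n)) ≤ U * n := by
  have h0 : ∀ w a, 0 ≤ Real.logb 2 (1 / q w a) := by
    intro w a
    refine Real.logb_nonneg one_lt_two ?_
    rw [le_div_iff₀ (hq w a), one_mul, ← hq1 w]
    exact Finset.single_le_sum (fun b _ => (hq w b).le) (Finset.mem_univ a)
  refine ⟨∑ s ∈ shortWords A D, ∑ a, Real.logb 2 (1 / q s a), fun n => ?_⟩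
  have h1 : ∀ w a, Real.logb 2 (1 / q w a)
      ≤ ∑ s ∈ shortWords A D, ∑ a, Real.logb 2 (1 / q s a) := by
    intro w a
    refine le_trans ?_ (Finset.single_le_sum
      (fun s _ => Finset.sum_nonneg fun a _ => h0 s a)
      (mem_shortWords.2 ((length_rtake w D).le.trans (min_le_right _ _))))
    rw [← hqD]
    exact Finset.single_le_sum (f := fun a => Real.logb 2 (1 / q (w.rtake D) a))
      (fun a _ => h0 _ a) (Finset.mem_univ a)
  rw [entropy_add_divergence hpos (seqCode_pos hq)]
  calc _ ≤ ∑ x : Fin n → A, μ.law x *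
        ((∑ s ∈ shortWords A D, ∑ a, Real.logb 2 (1 / q s a)) * n) := by
        refine Finset.sum_le_sum fun x _ => mul_le_mul_of_nonneg_left ?_ (law_nonneg μ x)
        rw [logb_one_div_seqCode hq]
        refine (Finset.sum_le_sum fun t _ => h1 _ _).trans ?_
        rw [Finset.sum_const, Finset.card_univ, Fintype.card_fin, nsmul_eq_mul, mul_comm]
    _ = _ := by rw [← Finset.sum_mul, sum_law, one_mul]

end Bounds

namespace ParametricFamily

/-- A one-letter alphabet carries only one source. -/
theorem nontrivial_alphabet {A : Type*} [Fintype A] {d h : ℕ} (F : ParametricFamily A d h)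
    (hd : 1 ≤ d) (hJ : F.jeffreysMass ≠ 0) (hJ' : F.jeffreysMass ≠ ⊤) : Nontrivial A := by
  by_contra hA
  rw [not_nontrivial_iff_subsingleton] at hA
  have := F.isProbabilityMeasure_jeffreys hJ hJ'
  have := F.nullSingletonClass_jeffreys hd
  have h1 : ∀ (μ : StationarySource A) w, μ.prob w = 1 := by
    intro μ w
    induction w with
    | nil => exact μ.prob_nil
    | cons a w ih =>
      have := μ.sum_cons w
      rwa [Fintype.sum_subsingleton _ a, ih] at this
  have h2 : F.Θ.Subsingleton := fun x hx y hy =>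
    F.identifiable hx hy (StationarySource.ext_prob fun w => by rw [h1, h1])
  have h3 := h2.measure_zero F.jeffreys
  have h4 := prob_compl_eq_zero_iff (μ := F.jeffreys) F.isOpen.measurableSet |>.1 F.ae_mem_jeffreys
  rw [h3] at h4
  exact zero_ne_one h4

end ParametricFamily

section MainTerm

theorem rtake_treeCond {A : Type*} (m : List A → ℝ) (D : ℕ) (w : List A) (a : A) :
    treeCond m D (w.rtake D) a = treeCond m D w a := by
  rw [treeCond, treeCond, rtake_rtake _ le_rfl]

variable {A : Type*} [Fintype A] {d h : ℕ} {F : ParametricFamily A d h} {K : ℕ} {p : Fin K → ℝ}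
  {θ : Fin K → Fin d → ℝ}

theorem entropy_add_divergence_pos [Nontrivial A] (hK : 2 ≤ K) (hp : ∀ i, 0 < p i)
    (hθ : ∀ i, θ i ∈ F.Θ) (D : ℕ) (i : Fin K) {n : ℕ} (hn : 1 ≤ n) :
    0 < entropy (F.source (θ i)) n + divergence (F.source (θ i)) (treeMixture F p θ D n) := by
  have hm := mixtureProb_pos hK hp hθ
  have h1 := le_symbolsPerBit_mul (F.pos _ (hθ i)) (treeCond_pos hm D)
    (sum_treeCond hm (mixtureProb_append F p θ) D) (rtake_treeCond _ D) n
  have h2 : (0 : ℝ) < n := by exact_mod_cast hn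
  have h3 : 0 ≤ entropy (F.source (θ i)) n +
      divergence (F.source (θ i)) (treeMixture F p θ D n) := by
    refine add_nonneg (entropy_nonneg _ _) ?_
    rw [treeMixture_eq_seqCode]
    refine sum_mul_logb_div_nonneg (fun x => F.pos _ (hθ i) _)
      (fun x => seqCode_pos (treeCond_pos hm D) x) ?_
    rw [sum_law, sum_seqCode (sum_treeCond hm (mixtureProb_append F p θ) D)]
  rw [treeMixture_eq_seqCode] at h3 ⊢
  refine h3.lt_of_ne fun h0 => ?_
  rw [← h0, mul_zero] at h1
  linarith

/-- Beyond finitely many `n`, the main term stays below one by more than any multiple of `1 / n`,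
because the divergence grows linearly and the minimax redundancy only logarithmically. -/
theorem eventually_mainTerm_add_lt_one [Nontrivial A] (hK : 2 ≤ K) (hp : ∀ i, 0 < p i)
    (hθ : ∀ i, θ i ∈ F.Θ) (D : ℕ) (i : Fin K)
    (hk : 0 < condDivergence (F.source (θ i)) (treeCond (mixtureProb F p θ) D) (max h D))
    (c : ℝ) : ∀ᶠ n : ℕ in atTop, mainTerm F p θ D i n + c / n < 1 := by
  have hm := mixtureProb_pos hK hp hθ
  obtain ⟨U, hU⟩ := exists_entropy_add_divergence_le (F.pos _ (hθ i)) (treeCond_pos hm D)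
    (sum_treeCond hm (mixtureProb_append F p θ) D) (rtake_treeCond _ D)
  have h1 : Tendsto (fun n : ℕ => divergence (F.source (θ i)) (treeMixture F p θ D n) / n
      - F.minimaxRedundancy n / n - |c| * U / n) atTop
      (𝓝 (condDivergence (F.source (θ i)) (treeCond (mixtureProb F p θ) D) (max h D)
        - 0 - 0)) :=
    ((tendsto_divergence_div hK hp hθ D i).sub F.tendsto_minimaxRedundancy_div).sub
      (tendsto_const_div_atTop_nhds_zero_nat _)
  rw [sub_zero, sub_zero] at h1
  filter_upwards [h1.eventually (lt_mem_nhds hk), eventually_ge_atTop 1] with n hn hn1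
  have hn0 : (0 : ℝ) < n := by exact_mod_cast hn1
  have hL := entropy_add_divergence_pos hK hp hθ D i hn1
  have hUn := hU n
  rw [← treeMixture_eq_seqCode] at hUn
  rw [← sub_div, ← sub_div, div_pos_iff_of_pos_right hn0] at hn
  rw [mainTerm, div_add_div _ _ hL.ne' hn0.ne', div_lt_one (by positivity)]
  have h2 : c * (entropy (F.source (θ i)) n +
      divergence (F.source (θ i)) (treeMixture F p θ D n)) ≤ |c| * (U * n) :=
    (mul_le_mul_of_nonneg_right (le_abs_self c) hL.le).trans
      (mul_le_mul_of_nonneg_left hUn (abs_nonneg c))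
  nlinarith

end MainTerm

/-! ### Concentration of the symbol counts -/

theorem sum_prod_mul {ι : Type*} [Fintype ι] [DecidableEq ι] {β : ι → Type*} [∀ j, Fintype (β j)]
    (f : ∀ j, β j → ℝ) : ∑ y : ∀ j, β j, ∏ j, f j (y j) = ∏ j, ∑ b, f j b := by
  rw [Finset.prod_univ_sum, Fintype.piFinset_univ]

/-- The second moment of a sum of independent centred variables. -/
theorem sum_prod_mul_sq {ι : Type*} [Fintype ι] [DecidableEq ι] {β : ι → Type*}
    [∀ j, Fintype (β j)] {m X : ∀ j, β j → ℝ} (hm : ∀ j, ∑ b, m j b = 1)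
    (hX : ∀ j, ∑ b, m j b * X j b = 0) :
    ∑ y : ∀ j, β j, (∏ j, m j (y j)) * (∑ j, X j (y j)) ^ 2 = ∑ j, ∑ b, m j b * X j b ^ 2 := by
  have h1 : ∀ j k, ∑ y : ∀ j, β j, (∏ i, m i (y i)) * (X j (y j) * X k (y k))
      = if j = k then ∑ b, m j b * X j b ^ 2 else 0 := by
    intro j k
    have h2 : ∀ y : ∀ j, β j, (∏ i, m i (y i)) * (X j (y j) * X k (y k))
        = ∏ i, m i (y i) * ((if i = j then X i (y i) else 1) * if i = k then X i (y i) else 1) := by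
      intro y
      rw [Finset.prod_mul_distrib, Finset.prod_mul_distrib]
      simp
    rw [Finset.sum_congr rfl fun y _ => h2 y, sum_prod_mul
      (fun i b => m i b * ((if i = j then X i b else 1) * if i = k then X i b else 1))]
    split_ifs with hjk
    · subst hjk
      rw [Finset.prod_eq_single j (fun i _ hi => by simp [hi, hm]) (by simp)]
      simp [pow_two]
    · refine Finset.prod_eq_zero (Finset.mem_univ j) ?_
      simp [hjk, hX]
  have h3 : ∀ y : ∀ j, β j, (∏ i, m i (y i)) * (∑ j, X j (y j)) ^ 2
      = ∑ j, ∑ k, (∏ i, m i (y i)) * (X j (y j) * X k (y k)) := fun y => by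
    simp only [pow_two, Finset.sum_mul_sum, ← Finset.mul_sum]
  rw [Finset.sum_congr rfl fun y _ => h3 y, Finset.sum_comm]
  refine Finset.sum_congr rfl fun j _ => ?_
  rw [Finset.sum_comm, Finset.sum_congr rfl fun k _ => h1 j k]
  simp

/-- Chebyshev's inequality for a sum of independent centred variables. -/
theorem sum_prod_mul_ite_le {ι : Type*} [Fintype ι] [DecidableEq ι] {β : ι → Type*}
    [∀ j, Fintype (β j)] {m X : ∀ j, β j → ℝ} (hm0 : ∀ j b, 0 ≤ m j b)
    (hm : ∀ j, ∑ b, m j b = 1) (hX : ∀ j, ∑ b, m j b * X j b = 0) {V : ι → ℝ}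
    (hV : ∀ j b, |X j b| ≤ V j) {r : ℝ} (hr : 0 < r) :
    ∑ y : ∀ j, β j, (∏ j, m j (y j)) * (if r ≤ |∑ j, X j (y j)| then 1 else 0)
      ≤ (∑ j, V j ^ 2) / r ^ 2 := by
  rw [le_div_iff₀ (by positivity), Finset.sum_mul]
  calc _ ≤ ∑ y : ∀ j, β j, (∏ j, m j (y j)) * (∑ j, X j (y j)) ^ 2 := by
        refine Finset.sum_le_sum fun y _ => ?_
        rw [mul_assoc]
        refine mul_le_mul_of_nonneg_left ?_ (Finset.prod_nonneg fun j _ => hm0 _ _)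
        split_ifs with h
        · rw [one_mul, ← sq_abs (∑ j, X j (y j))]
          gcongr
        · rw [zero_mul]
          positivity
    _ = ∑ j, ∑ b, m j b * X j b ^ 2 := sum_prod_mul_sq hm hX
    _ ≤ ∑ j, V j ^ 2 := by
        refine Finset.sum_le_sum fun j _ => ?_
        calc ∑ b, m j b * X j b ^ 2 ≤ ∑ b, m j b * V j ^ 2 := by
              refine Finset.sum_le_sum fun b _ => mul_le_mul_of_nonneg_left ?_ (hm0 j b)
              rw [← sq_abs]
              gcongr
              exact hV j b
          _ = V j ^ 2 := by rw [← Finset.sum_mul, hm, one_mul]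

/-- The number of positions for a word of length `k` in the first `T` memorized sequences. -/
noncomputable def windows (N : ℕ → ℕ) (k T : ℕ) : ℝ :=
  ∑ j ∈ Finset.range T, ((N j + 1 - k : ℕ) : ℝ)

section Windows

variable {D : ℕ} {N : ℕ → ℕ}

theorem le_windows (hN : ∀ j, D < N j) {k : ℕ} (hk : k ≤ D + 1) (T : ℕ) :
    (T : ℝ) ≤ windows N k T := by
  calc (T : ℝ) = ∑ _j ∈ Finset.range T, (1 : ℝ) := by simp
    _ ≤ _ := Finset.sum_le_sum fun j _ => by
        have := hN j
        exact_mod_cast (by omega : 1 ≤ N j + 1 - k)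

/-- Even if the sequences are so short that most of their symbols have no complete context, the number
of windows is comparable to the total length. -/
theorem sum_le_mul_windows (hN : ∀ j, D < N j) {k : ℕ} (hk : k ≤ D + 1) (T : ℕ) :
    ∑ j ∈ Finset.range T, (N j : ℝ) ≤ (D + 1) * windows N k T := by
  rw [windows, Finset.mul_sum]
  refine Finset.sum_le_sum fun j _ => ?_
  obtain ⟨r, hr⟩ : ∃ r, N j = D + 1 + r := ⟨N j - (D + 1), by have := hN j; omega⟩
  have h1 : 1 + r ≤ N j + 1 - k := by omega
  calc (N j : ℝ) ≤ (D + 1) * ((1 + r : ℕ) : ℝ) := by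
        rw [hr]
        push_cast
        nlinarith [mul_nonneg (Nat.cast_nonneg (α := ℝ) D) (Nat.cast_nonneg (α := ℝ) r)]
    _ ≤ _ := by gcongr

/-- No single memorized sequence matters in the limit: the sum of the squared lengths is negligible
against the square of their sum. It is compared termwise with the increments of that square. -/
theorem isLittleO_sum_sq (hN : ∀ j, D < N j)
    (hN' : Tendsto (fun T : ℕ => (N T : ℝ) / ∑ j ∈ Finset.range T, (N j : ℝ)) atTop (𝓝 0)) :
    (fun T => ∑ j ∈ Finset.range T, (N j : ℝ) ^ 2)
      =o[atTop] fun T => (∑ j ∈ Finset.range T, (N j : ℝ)) ^ 2 := by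
  set s : ℕ → ℝ := fun T => ∑ j ∈ Finset.range T, (N j : ℝ) with hs
  have hs0 : ∀ T, 0 ≤ s T := fun T => Finset.sum_nonneg fun j _ => Nat.cast_nonneg _
  have hs1 : ∀ T, s (T + 1) = s T + N T := fun T => Finset.sum_range_succ _ _
  have hsT : ∀ T : ℕ, (T : ℝ) ≤ s T := by
    intro T
    calc (T : ℝ) = ∑ _j ∈ Finset.range T, (1 : ℝ) := by simp
      _ ≤ _ := Finset.sum_le_sum fun j _ => by
        have := hN j
        exact_mod_cast (by omega : 1 ≤ N j)
  have hsum : ∀ T, ∑ j ∈ Finset.range T, (s (j + 1) ^ 2 - s j ^ 2) = s T ^ 2 := fun T => by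
    rw [Finset.sum_range_sub (fun j => s j ^ 2)]
    simp [hs]
  -- The increments are `N j * (2 * s j + N j)`, and `N j / s j` tends to zero.
  have h1 : (fun j => (N j : ℝ) ^ 2) =o[atTop] fun j => s (j + 1) ^ 2 - s j ^ 2 := by
    refine IsLittleO.of_bound fun c hc => ?_
    filter_upwards [hN'.eventually (gt_mem_nhds hc), eventually_ge_atTop 1] with j hj hj1
    have hsj : 0 < s j := lt_of_lt_of_le (by exact_mod_cast hj1) (hsT j)
    rw [div_lt_iff₀ hsj] at hj
    have hNj : (0 : ℝ) ≤ N j := Nat.cast_nonneg _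
    have h2 : s (j + 1) ^ 2 - s j ^ 2 = N j * (2 * s j + N j) := by rw [hs1]; ring
    rw [h2, Real.norm_of_nonneg (by positivity), Real.norm_of_nonneg (by positivity)]
    nlinarith [mul_le_mul_of_nonneg_left hj.le hNj, mul_nonneg hNj hsj.le,
      mul_nonneg hc.le (mul_nonneg hNj hsj.le), mul_nonneg hc.le (mul_nonneg hNj hNj)]
  have h3 := h1.sum_range (fun j => ?_) ?_
  · simpa only [hsum] using h3
  · simp only [Pi.zero_apply, hs1]
    nlinarith [hs0 j, Nat.cast_nonneg (α := ℝ) (N j)]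
  · simp only [hsum]
    refine tendsto_atTop_mono (fun T => ?_) (tendsto_natCast_atTop_atTop (R := ℝ))
    rcases Nat.eq_zero_or_pos T with rfl | hT
    · simp [hs]
    · have : (1 : ℝ) ≤ T := by exact_mod_cast hT
      nlinarith [hsT T]

theorem tendsto_sum_sq_div (hN : ∀ j, D < N j)
    (hN' : Tendsto (fun T : ℕ => (N T : ℝ) / ∑ j ∈ Finset.range T, (N j : ℝ)) atTop (𝓝 0))
    {k : ℕ} (hk : k ≤ D + 1) (δ : ℝ) :
    Tendsto (fun T => (∑ j ∈ Finset.range T, (N j : ℝ) ^ 2) / (δ * windows N k T) ^ 2) atTop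
      (𝓝 0) := by
  have h1 : (fun T => (∑ j ∈ Finset.range T, (N j : ℝ)) ^ 2)
      =O[atTop] fun T => windows N k T ^ 2 := by
    refine IsBigO.of_bound (((D : ℝ) + 1) ^ 2) (Eventually.of_forall fun T => ?_)
    have h2 := sum_le_mul_windows hN hk T
    have h3 : (0 : ℝ) ≤ ∑ j ∈ Finset.range T, (N j : ℝ) :=
      Finset.sum_nonneg fun j _ => Nat.cast_nonneg _
    rw [Real.norm_of_nonneg (by positivity), Real.norm_of_nonneg (by positivity), ← mul_pow]
    gcongr
  have h2 := ((isLittleO_sum_sq hN hN').trans_isBigO h1).tendsto_div_nhds_zero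
  have h3 := h2.const_mul ((δ ^ 2)⁻¹)
  rw [mul_zero] at h3
  refine h3.congr fun T => ?_
  rw [mul_pow, div_mul_eq_div_div, div_right_comm, inv_mul_eq_div]

end Windows

section Memory

variable {A : Type*} [Fintype A] {d h : ℕ} {F : ParametricFamily A d h} {K : ℕ}
  {p : Fin K → ℝ} {θ : Fin K → Fin d → ℝ}

/-- Averaged over the source indices, the memorized sequences are independent and follow the law
of the mixture. -/
theorem sum_mul_memoryProb {N : ℕ → ℕ} {T : ℕ} (y : Memory A N T) :
    ∑ z : Fin T → Fin K, (∏ j, p (z j)) * memoryProb F θ z y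
      = ∏ j, mixtureProb F p θ (List.ofFn (y j)) := by
  simp only [memoryProb, ← Finset.prod_mul_distrib]
  rw [sum_prod_mul (fun (j : Fin T) i => p i * (F.source (θ i)).law (y j))]
  rfl

theorem memoryProb_nonneg {N : ℕ → ℕ} {T : ℕ} (z : Fin T → Fin K) (y : Memory A N T) :
    0 ≤ memoryProb F θ z y :=
  Finset.prod_nonneg fun _ _ => law_nonneg _ _

theorem sum_memoryProb {N : ℕ → ℕ} {T : ℕ} (z : Fin T → Fin K) :
    ∑ y : Memory A N T, memoryProb F θ z y = 1 := by
  simp only [memoryProb]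
  rw [sum_prod_mul (fun (j : Fin T) x => (F.source (θ (z j))).law x)]
  simp [sum_law]

/-- The empirical frequencies of a word in the memory converge in probability to its probability
under the mixture. -/
theorem tendsto_prob_occ [DecidableEq A] (hK : 2 ≤ K) (hp : ∀ i, 0 < p i) (hp1 : ∑ i, p i = 1)
    (hθ : ∀ i, θ i ∈ F.Θ) {D : ℕ} {N : ℕ → ℕ} (hN : ∀ j, D < N j)
    (hN' : Tendsto (fun T : ℕ => (N T : ℝ) / ∑ j ∈ Finset.range T, (N j : ℝ)) atTop (𝓝 0))
    {w : List A} (hw : w ≠ []) (hwD : w.length ≤ D + 1) {δ : ℝ} (hδ : 0 < δ) :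
    Tendsto (fun T => ∑ y : Memory A N T, (∏ j, mixtureProb F p θ (List.ofFn (y j))) *
      (if δ * windows N w.length T ≤ |∑ j, (occ w (List.ofFn (y j)) : ℝ)
        - windows N w.length T * mixtureProb F p θ w| then 1 else 0)) atTop (𝓝 0) := by
  have hm := mixtureProb_pos hK hp hθ
  have hsum : ∀ n, ∑ x : Fin n → A, mixtureProb F p θ (List.ofFn x) = 1 := fun n => by
    simpa [mixtureProb_nil hp1] using sum_append_ofFn (mixtureProb_append F p θ) n []
  have hw1 : mixtureProb F p θ w ≤ 1 := by
    rw [← hsum w.length]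
    have := Finset.single_le_sum (s := Finset.univ) (f := fun x : Fin w.length → A =>
      mixtureProb F p θ (List.ofFn x)) (fun x _ => (hm _).le) (Finset.mem_univ w.get)
    simpa only [List.ofFn_get] using this
  have hlen : 0 < w.length := List.length_pos_iff.2 hw
  refine squeeze_zero' (Eventually.of_forall fun T => Finset.sum_nonneg fun y _ =>
    mul_nonneg (Finset.prod_nonneg fun j _ => (hm _).le) (by split_ifs <;> simp)) ?_
    (tendsto_sum_sq_div hN hN' hwD δ)
  filter_upwards [eventually_ge_atTop 1] with T hT
  have hwin : 0 < windows N w.length T :=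
    lt_of_lt_of_le (by exact_mod_cast hT) (le_windows hN hwD T)
  have key := sum_prod_mul_ite_le (ι := Fin T) (β := fun j => Fin (N j) → A)
    (m := fun j x => mixtureProb F p θ (List.ofFn x))
    (X := fun j x => occ w (List.ofFn x) - ((N j + 1 - w.length : ℕ) : ℝ) * mixtureProb F p θ w)
    (V := fun j => (N j : ℝ)) (fun j x => (hm _).le) (fun j => hsum _) (fun j => ?_)
    (fun j x => ?_) (mul_pos hδ hwin)
  · rw [Finset.sum_range]
    refine le_trans (le_of_eq ?_) key
    refine Finset.sum_congr rfl fun y _ => ?_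
    rw [Finset.sum_sub_distrib, ← Finset.sum_mul, windows, Finset.sum_range]
  · simp only [mul_sub]
    rw [Finset.sum_sub_distrib, sum_mul_occ (mixtureProb_append F p θ) (mixtureProb_cons F p θ) hw,
      ← Finset.sum_mul, hsum, one_mul, sub_self]
  · have h1 : (occ w (List.ofFn x) : ℝ) ≤ N j := by
      exact_mod_cast (occ_le_length hw _).trans (by simp)
    have h2 : ((N j + 1 - w.length : ℕ) : ℝ) ≤ N j := by
      exact_mod_cast (by omega : N j + 1 - w.length ≤ N j)
    have h3 : ((N j + 1 - w.length : ℕ) : ℝ) * mixtureProb F p θ w ≤ N j := by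
      nlinarith [hm w, Nat.cast_nonneg (α := ℝ) (N j + 1 - w.length)]
    have h4 : 0 ≤ ((N j + 1 - w.length : ℕ) : ℝ) * mixtureProb F p θ w :=
      mul_nonneg (Nat.cast_nonneg _) (hm w).le
    rw [abs_le]
    constructor <;> linarith [Nat.cast_nonneg (α := ℝ) (occ w (List.ofFn x))]

end Memory

/-! ### Convergence of the length ratio -/

section Ratio

variable {A : Type*} [Fintype A]

theorem entropy_pos [Nontrivial A] {μ : StationarySource A} (hpos : ∀ w, 0 < μ.prob w) {n : ℕ}
    (hn : 1 ≤ n) : 0 < entropy μ n := by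
  have : Nonempty (Fin n) := ⟨⟨0, hn⟩⟩
  refine Finset.sum_pos (fun x _ => mul_pos (hpos _) (Real.logb_pos one_lt_two ?_))
    Finset.univ_nonempty
  rw [lt_div_iff₀ (show 0 < μ.law x from hpos _), one_mul]
  exact lt_one_of_sum_eq_one (fun y : Fin n → A => hpos _) (sum_law μ n) x

theorem entropy_le_expect {μ : StationarySource A} (hpos : ∀ w, 0 < μ.prob w) {n : ℕ}
    {l : (Fin n → A) → ℝ} (hl : IsLengthFunction l) : entropy μ n ≤ expect μ l :=
  sub_nonneg.1 (redundancy_nonneg hpos hl)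

theorem isLengthFunction_memoryLength [Nonempty A] [DecidableEq A] (D : ℕ) {α : ℝ} (hα : 0 < α)
    {N : ℕ → ℕ} {T : ℕ} (y : Memory A N T) (n : ℕ) :
    IsLengthFunction (memoryLength D α y (n := n)) := by
  let q : List A → A → ℝ := fun w a =>
    (((∑ j, occ (w.rtake D ++ [a]) (List.ofFn (y j)) + occ (w.rtake D ++ [a]) w : ℕ) : ℝ) + α) /
      ∑ b, (((∑ j, occ (w.rtake D ++ [b]) (List.ofFn (y j)) + occ (w.rtake D ++ [b]) w : ℕ) : ℝ)
        + α)
  have hcode : ∀ x : Fin n → A, memoryCode D α y x = seqCode q x := fun x => by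
    simp only [memoryCode, seqCode, count, context_eq_rtake, q]
  have hc : ∀ (w : List A) (b : A), 0 < ((∑ j, occ (w.rtake D ++ [b]) (List.ofFn (y j))
      + occ (w.rtake D ++ [b]) w : ℕ) : ℝ) + α := fun w b => by positivity
  have hs : ∀ w : List A, 0 < ∑ b, (((∑ j, occ (w.rtake D ++ [b]) (List.ofFn (y j))
      + occ (w.rtake D ++ [b]) w : ℕ) : ℝ) + α) := fun w =>
    Finset.sum_pos (fun b _ => hc w b) Finset.univ_nonempty
  have hq : ∀ w a, 0 < q w a := fun w a => div_pos (hc w a) (hs w)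
  have hq1 : ∀ w, ∑ a, q w a = 1 := fun w => by
    simp only [q]
    rw [← Finset.sum_div, div_self (hs w).ne']
  rw [IsLengthFunction, ← sum_seqCode hq1 n]
  refine le_of_eq (Finset.sum_congr rfl fun x _ => ?_)
  have := seqCode_pos hq x
  rw [memoryLength, hcode, one_div, Real.logb_inv, neg_neg,
    Real.rpow_logb two_pos (by norm_num) this]

/-- Since the code with memory satisfies Kraft's inequality, it is no shorter than the entropy, which
bounds the length ratio uniformly in the memory. -/
theorem lengthRatio_mem [Nontrivial A] [DecidableEq A] {μ : StationarySource A}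
    (hpos : ∀ w, 0 < μ.prob w) {n : ℕ} (hn : 1 ≤ n) {l : (Fin n → A) → ℝ}
    (hl : IsLengthFunction l) (D : ℕ) {α : ℝ} (hα : 0 < α) {N : ℕ → ℕ} {T : ℕ}
    (y : Memory A N T) :
    lengthRatio μ l D α y ∈ Set.Icc 0 (expect μ l / entropy μ n) := by
  have h1 := entropy_pos hpos hn
  have h2 := entropy_le_expect hpos (isLengthFunction_memoryLength D hα y n)
  have h3 := entropy_le_expect hpos hl
  exact ⟨div_nonneg (h1.le.trans h3) (h1.le.trans h2),
    div_le_div_of_nonneg_left (h1.le.trans h3) h1 h2⟩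

/-- The ratio of the expected length with `l` to that of a sequential code, as a function of the
(unnormalized) weights `u x t b` with which the code predicts the symbol `b` at position `t`. -/
noncomputable def weightRatio (μ : StationarySource A) {n : ℕ} (l : (Fin n → A) → ℝ)
    (u : (Fin n → A) → Fin n → A → ℝ) : ℝ :=
  expect μ l / expect μ fun x => Real.logb 2 (1 / ∏ t, u x t (x t) / ∑ b, u x t b)

theorem continuousAt_weightRatio {μ : StationarySource A} {n : ℕ} (l : (Fin n → A) → ℝ)
    {u : (Fin n → A) → Fin n → A → ℝ} (hu : ∀ x t b, 0 < u x t b)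
    (h0 : (expect μ fun x => Real.logb 2 (1 / ∏ t, u x t (x t) / ∑ b, u x t b)) ≠ 0) :
    ContinuousAt (weightRatio μ l) u := by
  refine continuousAt_const.div ?_ h0
  refine tendsto_finsetSum _ fun x _ => Tendsto.const_mul _ ?_
  have hs : ∀ t, 0 < ∑ b, u x t b := fun t =>
    Finset.sum_pos (fun b _ => hu x t b) ⟨x t, Finset.mem_univ _⟩
  have h1 : ∀ t b, ContinuousAt (fun u : (Fin n → A) → Fin n → A → ℝ => u x t b) u :=
    fun t b =>
      ((continuous_apply b).comp ((continuous_apply t).comp (continuous_apply x))).continuousAt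
  have h2 : ContinuousAt (fun u : (Fin n → A) → Fin n → A → ℝ =>
      ∏ t, u x t (x t) / ∑ b, u x t b) u :=
    tendsto_finsetProd _ fun t _ => (h1 t (x t)).div
      (tendsto_finsetSum _ fun b _ => h1 t b) (hs t).ne'
  have h3 : 0 < ∏ t, u x t (x t) / ∑ b, u x t b :=
    Finset.prod_pos fun t _ => div_pos (hu _ _ _) (hs t)
  exact ((continuousAt_const.div h2 h3.ne').log (one_div_pos.2 h3).ne').div_const _

/-- The coding probabilities do not change if the counts are divided by factors that depend only on
the length of the counted word. -/
theorem lengthRatio_eq_weightRatio [DecidableEq A] (μ : StationarySource A) {n : ℕ}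
    (l : (Fin n → A) → ℝ) (D : ℕ) (α : ℝ) {N : ℕ → ℕ} {T : ℕ} (y : Memory A N T) {s : ℕ → ℝ}
    (hs : ∀ k, k ≤ D + 1 → s k ≠ 0) :
    lengthRatio μ l D α y = weightRatio μ l fun x t b =>
      ((count y x t (context D x t ++ [b]) : ℝ) + α) / s ((context D x t).length + 1) := by
  rw [lengthRatio, weightRatio]
  congr 1
  refine Finset.sum_congr rfl fun x _ => ?_
  rw [memoryLength, memoryCode]
  congr 3
  refine Finset.prod_congr rfl fun t _ => ?_
  rw [← Finset.sum_div, div_div_div_cancel_right₀]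
  refine hs _ ?_
  rw [context_eq_rtake, length_rtake]
  omega

variable {d h : ℕ} {F : ParametricFamily A d h} {K : ℕ} {p : Fin K → ℝ} {θ : Fin K → Fin d → ℝ}

variable (F p) in
/-- The ratio of the expected length with `l` to that of the code with infinite memory. -/
noncomputable def limitRatio (D : ℕ) (i : Fin K) {n : ℕ} (l : (Fin n → A) → ℝ)
    (θ : Fin K → Fin d → ℝ) : ℝ :=
  expect (F.source (θ i)) l /
    (entropy (F.source (θ i)) n + divergence (F.source (θ i)) (treeMixture F p θ D n))

theorem limitRatio_eq_weightRatio (hK : 2 ≤ K) (hp : ∀ i, 0 < p i) (hθ : ∀ i, θ i ∈ F.Θ) (D : ℕ)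
    (i : Fin K) {n : ℕ} (l : (Fin n → A) → ℝ) :
    limitRatio F p D i l θ = weightRatio (F.source (θ i)) l
      fun x t b => mixtureProb F p θ (context D x t ++ [b]) := by
  have hq : ∀ x : Fin n → A, 0 < treeMixture F p θ D n x := fun x => by
    rw [treeMixture_eq_seqCode]
    exact seqCode_pos (treeCond_pos (mixtureProb_pos hK hp hθ) D) x
  rw [limitRatio, weightRatio, entropy_add_divergence (F.pos _ (hθ i)) hq, expect, expect]
  simp only [treeMixture, mixtureProb_append]

/-- The length ratio converges in probability as the memory grows. -/
theorem tendsto_prob_lengthRatio [Nontrivial A] [DecidableEq A] (hK : 2 ≤ K) (hp : ∀ i, 0 < p i)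
    (hp1 : ∑ i, p i = 1) (hθ : ∀ i, θ i ∈ F.Θ) {D : ℕ} {α : ℝ} (hα : 0 < α) {N : ℕ → ℕ}
    (hN : ∀ j, D < N j)
    (hN' : Tendsto (fun T : ℕ => (N T : ℝ) / ∑ j ∈ Finset.range T, (N j : ℝ)) atTop (𝓝 0))
    (i : Fin K) {n : ℕ} (hn : 1 ≤ n) (l : (Fin n → A) → ℝ) {η : ℝ} (hη : 0 < η) :
    Tendsto (fun T => ∑ y : Memory A N T, (∏ j, mixtureProb F p θ (List.ofFn (y j))) *
      (if η ≤ |lengthRatio (F.source (θ i)) l D α y - limitRatio F p D i l θ| then 1 else 0))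
      atTop (𝓝 0) := by
  have hm := mixtureProb_pos hK hp hθ
  set v : (Fin n → A) → Fin n → A → ℝ := fun x t b =>
    mixtureProb F p θ (context D x t ++ [b]) with hv
  have hc : ContinuousAt (weightRatio (F.source (θ i)) l) v := by
    refine continuousAt_weightRatio l (fun x t b => hm _) ?_
    have h1 := entropy_add_divergence_pos hK hp hθ D i hn
    rw [entropy_add_divergence (F.pos _ (hθ i)) fun x => by
      rw [treeMixture_eq_seqCode]
      exact seqCode_pos (treeCond_pos hm D) x] at h1
    simp only [treeMixture] at h1
    simp only [hv, mixtureProb_append]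
    exact h1.ne'
  obtain ⟨δ, hδ, hδc⟩ := Metric.continuousAt_iff.1 hc η hη
  have hlen : ∀ (x : Fin n → A) (t : Fin n), (context D x t).length + 1 ≤ D + 1 := fun x t => by
    rw [context_eq_rtake, length_rtake]
    omega
  have hlim : Tendsto (fun T => ∑ x : Fin n → A, ∑ t : Fin n, ∑ b : A, ∑ y : Memory A N T,
      (∏ j, mixtureProb F p θ (List.ofFn (y j))) *
      (if δ / 2 * windows N (context D x t ++ [b]).length T ≤
        |∑ j, (occ (context D x t ++ [b]) (List.ofFn (y j)) : ℝ)
        - windows N (context D x t ++ [b]).length T * mixtureProb F p θ (context D x t ++ [b])|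
        then 1 else 0)) atTop (𝓝 0) := by
    have h1 := tendsto_finsetSum (Finset.univ : Finset (Fin n → A)) fun x _ =>
      tendsto_finsetSum (Finset.univ : Finset (Fin n)) fun t _ =>
        tendsto_finsetSum (Finset.univ : Finset A) fun b _ =>
          tendsto_prob_occ hK hp hp1 hθ hN hN' (w := context D x t ++ [b]) (by simp)
            (by simpa using hlen x t) (half_pos hδ)
    simpa using h1
  refine squeeze_zero' (Eventually.of_forall fun T => Finset.sum_nonneg fun y _ =>
    mul_nonneg (Finset.prod_nonneg fun j _ => (hm _).le) (by split_ifs <;> simp)) ?_ hlim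
  -- For large `T` the bias `α` and the at most `n` occurrences within `x` itself are negligible.
  obtain ⟨T₀, hT₀⟩ := exists_nat_gt (2 * (n + α) / δ)
  filter_upwards [eventually_ge_atTop (max T₀ 1)] with T hT
  have hT1 : 1 ≤ T := (le_max_right _ _).trans hT
  have hwin : ∀ k, k ≤ D + 1 → n + α < δ / 2 * windows N k T := fun k hk => by
    have h1 : (T₀ : ℝ) ≤ T := by exact_mod_cast (le_max_left _ _).trans hT
    have h2 := hT₀.trans_le (h1.trans (le_windows hN hk T))
    rw [div_lt_iff₀ hδ] at h2
    linarith
  have hwin0 : ∀ k, k ≤ D + 1 → 0 < windows N k T := fun k hk => by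
    have h1 : (1 : ℝ) ≤ T := by exact_mod_cast hT1
    linarith [le_windows hN hk T]
  have h3 : ∀ y : Memory A N T,
      (if η ≤ |lengthRatio (F.source (θ i)) l D α y - limitRatio F p D i l θ| then (1 : ℝ) else 0)
      ≤ ∑ x : Fin n → A, ∑ t : Fin n, ∑ b : A,
      (if δ / 2 * windows N (context D x t ++ [b]).length T ≤
        |∑ j, (occ (context D x t ++ [b]) (List.ofFn (y j)) : ℝ)
        - windows N (context D x t ++ [b]).length T * mixtureProb F p θ (context D x t ++ [b])|
        then 1 else 0) := by
    intro y
    have hnn : ∀ (x : Fin n → A) (t : Fin n) (b : A), (0 : ℝ) ≤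
        (if δ / 2 * windows N (context D x t ++ [b]).length T ≤
        |∑ j, (occ (context D x t ++ [b]) (List.ofFn (y j)) : ℝ)
        - windows N (context D x t ++ [b]).length T * mixtureProb F p θ (context D x t ++ [b])|
        then 1 else 0) := fun x t b => by split_ifs <;> simp
    split_ifs with hy
    swap
    · exact Finset.sum_nonneg fun x _ => Finset.sum_nonneg fun t _ =>
        Finset.sum_nonneg fun b _ => hnn x t b
    have h4 : ∃ x t b, δ ≤ |((count y x t (context D x t ++ [b]) : ℝ) + α) /
        windows N ((context D x t).length + 1) T - v x t b| := by
      by_contra! hcon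
      refine absurd (hδc (x := fun x t b => ((count y x t (context D x t ++ [b]) : ℝ) + α) /
        windows N ((context D x t).length + 1) T) ?_) ?_
      · simp only [dist_pi_lt_iff hδ]
        exact fun x t b => hcon x t b
      · rw [not_lt, Real.dist_eq, ← lengthRatio_eq_weightRatio (s := fun k => windows N k T)
          _ l D α y fun k hk => (hwin0 k hk).ne', ← limitRatio_eq_weightRatio hK hp hθ]
        exact hy
    obtain ⟨x, t, b, hxtb⟩ := h4
    refine le_trans ?_ (Finset.single_le_sum (fun x _ => Finset.sum_nonneg fun t _ =>
      Finset.sum_nonneg fun b _ => hnn x t b) (Finset.mem_univ x))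
    refine le_trans ?_ (Finset.single_le_sum (fun t _ =>
      Finset.sum_nonneg fun b _ => hnn x t b) (Finset.mem_univ t))
    refine le_trans ?_ (Finset.single_le_sum (fun b _ => hnn x t b) (Finset.mem_univ b))
    have hl1 : (context D x t ++ [b]).length = (context D x t).length + 1 := by simp
    refine (if_pos ?_).ge
    rw [hl1]
    have hW := hwin0 _ (hlen x t)
    have hW' := hwin _ (hlen x t)
    set W := windows N ((context D x t).length + 1) T
    rw [div_sub' hW.ne', abs_div, abs_of_pos hW, le_div_iff₀ hW] at hxtb
    have hocc : ((occ (context D x t ++ [b]) ((List.ofFn x).take t) : ℕ) : ℝ) ≤ n := by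
      exact_mod_cast (occ_le_length (by simp) _).trans (by simp)
    have hcount : (count y x t (context D x t ++ [b]) : ℝ)
        = ∑ j, (occ (context D x t ++ [b]) (List.ofFn (y j)) : ℝ)
          + occ (context D x t ++ [b]) ((List.ofFn x).take t) := by
      rw [count]
      push_cast
      rfl
    rw [hcount] at hxtb
    have h5 : ∀ s o : ℝ, 0 ≤ o → o ≤ n → δ * W ≤ |s + o + α - W * v x t b| →
        δ / 2 * W ≤ |s - W * v x t b| := by
      intro s o ho ho' hs
      have h6 : |s + o + α - W * v x t b| ≤ |s - W * v x t b| + |o + α| := by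
        refine le_trans (le_of_eq ?_) (abs_add_le _ _)
        congr 1
        ring
      rw [abs_of_pos (by linarith : 0 < o + α)] at h6
      linarith
    exact h5 _ _ (Nat.cast_nonneg _) hocc hxtb
  calc _ ≤ ∑ y : Memory A N T, (∏ j, mixtureProb F p θ (List.ofFn (y j))) * _ :=
        Finset.sum_le_sum fun y _ => mul_le_mul_of_nonneg_left (h3 y)
          (Finset.prod_nonneg fun j _ => (hm _).le)
    _ = _ := by
        simp only [Finset.mul_sum]
        rw [Finset.sum_comm]
        refine Finset.sum_congr rfl fun x _ => ?_
        rw [Finset.sum_comm]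
        refine Finset.sum_congr rfl fun t _ => ?_
        rw [Finset.sum_comm]

end Ratio

/-! ### The gain as a quantile -/

/-- A joint law of the parameter vectors that lives on `Θ` and for which the word probabilities are
measurable. Jeffreys' prior and the point masses in `Θ` are examples. -/
structure IsAdmissible {A : Type*} [Fintype A] {d h : ℕ} (F : ParametricFamily A d h) {K : ℕ}
    (ν : Measure (Fin K → Fin d → ℝ)) : Prop where
  prob : IsProbabilityMeasure ν
  mem : ∀ᵐ θ ∂ν, ∀ i, θ i ∈ F.Θ
  aemeasurable_prob : ∀ i w, AEMeasurable (fun θ => (F.source (θ i)).prob w) ν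

section Measurability

variable {A : Type*} [Fintype A] {d h : ℕ} {F : ParametricFamily A d h} {K : ℕ} {p : Fin K → ℝ}
  {ν : Measure (Fin K → Fin d → ℝ)}

theorem IsAdmissible.dirac {θ : Fin K → Fin d → ℝ} (hθ : ∀ i, θ i ∈ F.Θ) :
    IsAdmissible F (Measure.dirac θ) where
  prob := inferInstance
  mem := by
    rw [ae_dirac_eq]
    exact hθ
  aemeasurable_prob _ _ := aemeasurable_dirac

theorem isAdmissible_prior (hJ : F.jeffreysMass ≠ 0) (hJ' : F.jeffreysMass ≠ ⊤) :
    IsAdmissible F (F.prior K) where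
  prob := F.isProbabilityMeasure_prior hJ hJ'
  mem := F.ae_mem_prior hJ hJ'
  aemeasurable_prob := F.aemeasurable_prob_prior hJ hJ'

theorem aemeasurable_logb_two {Ω : Type*} [MeasurableSpace Ω] {μ : Measure Ω} {f : Ω → ℝ}
    (hf : AEMeasurable f μ) : AEMeasurable (fun ω => Real.logb 2 (f ω)) μ :=
  (Real.measurable_log.comp_aemeasurable hf).div_const _

namespace IsAdmissible

theorem aemeasurable_expect (hν : IsAdmissible F ν) (i : Fin K) {n : ℕ}
    {f : (Fin K → Fin d → ℝ) → (Fin n → A) → ℝ} (hf : ∀ x, AEMeasurable (fun θ => f θ x) ν) :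
    AEMeasurable (fun θ => expect (F.source (θ i)) (f θ)) ν :=
  Finset.aemeasurable_fun_sum _ fun x _ => (hν.aemeasurable_prob i _).mul (hf x)

theorem aemeasurable_expect_const (hν : IsAdmissible F ν) (i : Fin K) {n : ℕ}
    (f : (Fin n → A) → ℝ) : AEMeasurable (fun θ => expect (F.source (θ i)) f) ν :=
  hν.aemeasurable_expect i (f := fun _ => f) fun _ => aemeasurable_const

theorem aemeasurable_entropy (hν : IsAdmissible F ν) (i : Fin K) (n : ℕ) :
    AEMeasurable (fun θ => entropy (F.source (θ i)) n) ν := by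
  unfold entropy
  exact hν.aemeasurable_expect i fun _ =>
    aemeasurable_logb_two (aemeasurable_const.fun_div (hν.aemeasurable_prob i _))

theorem aemeasurable_mixtureProb (hν : IsAdmissible F ν) (w : List A) :
    AEMeasurable (fun θ => mixtureProb F p θ w) ν :=
  Finset.aemeasurable_fun_sum _ fun i _ => (hν.aemeasurable_prob i w).const_mul _

theorem aemeasurable_treeCond (hν : IsAdmissible F ν) (D : ℕ) (w : List A) (a : A) :
    AEMeasurable (fun θ => treeCond (mixtureProb F p θ) D w a) ν := by
  unfold treeCond
  exact (hν.aemeasurable_mixtureProb _).fun_div (hν.aemeasurable_mixtureProb _)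

theorem aemeasurable_treeMixture (hν : IsAdmissible F ν) (D : ℕ) {n : ℕ} (x : Fin n → A) :
    AEMeasurable (fun θ => treeMixture F p θ D n x) ν := by
  unfold treeMixture
  exact Finset.aemeasurable_fun_prod _ fun _ _ =>
    (hν.aemeasurable_mixtureProb _).fun_div (hν.aemeasurable_mixtureProb _)

theorem aemeasurable_divergence (hν : IsAdmissible F ν) (D : ℕ) (i : Fin K) (n : ℕ) :
    AEMeasurable (fun θ => divergence (F.source (θ i)) (treeMixture F p θ D n)) ν := by
  unfold divergence
  exact hν.aemeasurable_expect i fun x => aemeasurable_logb_two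
    ((hν.aemeasurable_prob i _).fun_div (hν.aemeasurable_treeMixture D x))

theorem aemeasurable_limitRatio (hν : IsAdmissible F ν) (D : ℕ) (i : Fin K) {n : ℕ}
    (l : (Fin n → A) → ℝ) : AEMeasurable (limitRatio F p D i l) ν := by
  unfold limitRatio
  exact (hν.aemeasurable_expect_const i _).fun_div
    ((hν.aemeasurable_entropy i n).fun_add (hν.aemeasurable_divergence D i n))

theorem aemeasurable_mainTerm (hν : IsAdmissible F ν) (D : ℕ) (i : Fin K) (n : ℕ) :
    AEMeasurable (fun θ => mainTerm F p θ D i n) ν := by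
  unfold mainTerm
  exact ((hν.aemeasurable_entropy i n).add_const _).fun_div
    ((hν.aemeasurable_entropy i n).fun_add (hν.aemeasurable_divergence D i n))

theorem aemeasurable_symbolsPerBit (hν : IsAdmissible F ν) (D : ℕ) :
    AEMeasurable (fun θ => symbolsPerBit (treeCond (mixtureProb F p θ) D) D) ν := by
  unfold symbolsPerBit
  exact Finset.aemeasurable_fun_sum _ fun _ _ => Finset.aemeasurable_fun_sum _ fun _ _ =>
    (aemeasurable_const.fun_sub (hν.aemeasurable_treeCond D _ _)).inv

theorem aemeasurable_lengthRatio [DecidableEq A] (hν : IsAdmissible F ν) (D : ℕ) (α : ℝ)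
    (i : Fin K) {n : ℕ} (l : (Fin n → A) → ℝ) {N : ℕ → ℕ} {T : ℕ} (y : Memory A N T) :
    AEMeasurable (fun θ => lengthRatio (F.source (θ i)) l D α y) ν := by
  unfold lengthRatio
  exact (hν.aemeasurable_expect_const i _).fun_div
    (hν.aemeasurable_expect_const i _)

theorem aemeasurable_memoryProb (hν : IsAdmissible F ν) {N : ℕ → ℕ} {T : ℕ} (z : Fin T → Fin K)
    (y : Memory A N T) : AEMeasurable (fun θ => memoryProb F θ z y) ν :=
  Finset.aemeasurable_fun_prod _ fun _ _ => hν.aemeasurable_prob _ _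

end IsAdmissible

end Measurability

section Gain

variable {A : Type*} [Fintype A] [DecidableEq A] {d h : ℕ} {F : ParametricFamily A d h} {K : ℕ}
  {p : Fin K → ℝ} {ν : Measure (Fin K → Fin d → ℝ)}

variable (F p) in
/-- The probability, for given parameter vectors and source indices, that the length ratio differs
from its limit by at least `η`. -/
noncomputable def deviationProb (D : ℕ) (α : ℝ) (N : ℕ → ℕ) {T : ℕ} (z : Fin T → Fin K) (i : Fin K)
    {n : ℕ} (l : (Fin n → A) → ℝ) (η : ℝ) (θ : Fin K → Fin d → ℝ) : ℝ :=
  ∑ y : Memory A N T, memoryProb F θ z y *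
    (if η ≤ |lengthRatio (F.source (θ i)) l D α y - limitRatio F p D i l θ| then 1 else 0)

theorem deviationProb_nonneg (D : ℕ) (α : ℝ) (N : ℕ → ℕ) {T : ℕ} (z : Fin T → Fin K) (i : Fin K)
    {n : ℕ} (l : (Fin n → A) → ℝ) (η : ℝ) (θ : Fin K → Fin d → ℝ) :
    0 ≤ deviationProb F p D α N z i l η θ :=
  Finset.sum_nonneg fun y _ => mul_nonneg (memoryProb_nonneg z y) (by split_ifs <;> simp)

theorem deviationProb_le_one (D : ℕ) (α : ℝ) (N : ℕ → ℕ) {T : ℕ} (z : Fin T → Fin K) (i : Fin K)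
    {n : ℕ} (l : (Fin n → A) → ℝ) (η : ℝ) (θ : Fin K → Fin d → ℝ) :
    deviationProb F p D α N z i l η θ ≤ 1 := by
  rw [← sum_memoryProb (F := F) (θ := θ) (N := N) z]
  exact Finset.sum_le_sum fun y _ => mul_le_of_le_one_right (memoryProb_nonneg z y)
    (by split_ifs <;> simp)

theorem IsAdmissible.aemeasurable_deviationProb (hν : IsAdmissible F ν) (D : ℕ) (α : ℝ) (N : ℕ → ℕ)
    {T : ℕ} (z : Fin T → Fin K) (i : Fin K) {n : ℕ} (l : (Fin n → A) → ℝ) (η : ℝ) :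
    AEMeasurable (deviationProb F p D α N z i l η) ν := by
  have h1 : Measurable fun t : ℝ => if η ≤ |t| then (1 : ℝ) else 0 :=
    Measurable.ite (measurableSet_le measurable_const measurable_norm) measurable_const
      measurable_const
  exact Finset.aemeasurable_fun_sum _ fun y _ => (hν.aemeasurable_memoryProb z y).mul
    (h1.comp_aemeasurable ((hν.aemeasurable_lengthRatio D α i l y).sub
      (hν.aemeasurable_limitRatio D i l)))

theorem IsAdmissible.integrable_deviationProb (hν : IsAdmissible F ν) (D : ℕ) (α : ℝ) (N : ℕ → ℕ)
    {T : ℕ} (z : Fin T → Fin K) (i : Fin K) {n : ℕ} (l : (Fin n → A) → ℝ) (η : ℝ) :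
    Integrable (deviationProb F p D α N z i l η) ν := by
  have := hν.prob
  refine Integrable.of_bound (hν.aemeasurable_deviationProb D α N z i l η).aestronglyMeasurable 1
    (Eventually.of_forall fun θ => ?_)
  rw [Real.norm_of_nonneg (deviationProb_nonneg D α N z i l η θ)]
  exact deviationProb_le_one D α N z i l η θ

theorem sum_prod_weights (hp1 : ∑ i, p i = 1) (T : ℕ) : ∑ z : Fin T → Fin K, ∏ j, p (z j) = 1 := by
  rw [sum_prod_mul (fun (_ : Fin T) i => p i)]
  simp [hp1]

/-- Averaged over the source indices and the parameter vectors, the probability of a deviation of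
the length ratio from its limit tends to zero. -/
theorem tendsto_mean_deviationProb [Nontrivial A] (hν : IsAdmissible F ν) (hK : 2 ≤ K)
    (hp : ∀ i, 0 < p i) (hp1 : ∑ i, p i = 1) {D : ℕ} {α : ℝ} (hα : 0 < α) {N : ℕ → ℕ}
    (hN : ∀ j, D < N j)
    (hN' : Tendsto (fun T : ℕ => (N T : ℝ) / ∑ j ∈ Finset.range T, (N j : ℝ)) atTop (𝓝 0))
    (i : Fin K) {n : ℕ} (hn : 1 ≤ n) (l : (Fin n → A) → ℝ) {η : ℝ} (hη : 0 < η) :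
    Tendsto (fun T => ∑ z : Fin T → Fin K, (∏ j, p (z j)) *
      ∫ θ, deviationProb F p D α N z i l η θ ∂ν) atTop (𝓝 0) := by
  have := hν.prob
  have hw : ∀ {T : ℕ} (z : Fin T → Fin K), 0 ≤ ∏ j, p (z j) := fun z =>
    Finset.prod_nonneg fun j _ => (hp _).le
  have h1 : ∀ T : ℕ, ∑ z : Fin T → Fin K, (∏ j, p (z j)) *
      ∫ θ, deviationProb F p D α N z i l η θ ∂ν = ∫ θ, ∑ z : Fin T → Fin K, (∏ j, p (z j)) *
        deviationProb F p D α N z i l η θ ∂ν := fun T => by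
    rw [integral_finsetSum _ fun z _ =>
      (hν.integrable_deviationProb D α N z i l η).const_mul _]
    simp only [integral_const_mul]
  simp only [h1]
  rw [← integral_zero (Fin K → Fin d → ℝ) ℝ (μ := ν)]
  refine tendsto_integral_of_dominated_convergence (fun _ => 1) (fun T => ?_)
    (integrable_const _) (fun T => Eventually.of_forall fun θ => ?_) ?_
  · exact (Finset.aemeasurable_fun_sum _ fun z _ =>
      (hν.aemeasurable_deviationProb D α N z i l η).const_mul _).aestronglyMeasurable
  · rw [Real.norm_of_nonneg (Finset.sum_nonneg fun z _ =>
      mul_nonneg (hw z) (deviationProb_nonneg D α N z i l η θ)), ← sum_prod_weights hp1 T]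
    exact Finset.sum_le_sum fun z _ =>
      mul_le_of_le_one_right (hw z) (deviationProb_le_one D α N z i l η θ)
  · filter_upwards [hν.mem] with θ hθ
    refine (tendsto_prob_lengthRatio hK hp hp1 hθ hα hN hN' i hn l hη).congr fun T => ?_
    simp only [deviationProb, Finset.mul_sum, ← mul_assoc]
    rw [Finset.sum_comm]
    refine Finset.sum_congr rfl fun y _ => ?_
    rw [← Finset.sum_mul, sum_mul_memoryProb]

/-- If `X` bounds the limit ratio, the length ratio exceeds `r₀ + η` only if `X` reaches `r₀` or the
length ratio deviates from its limit by at least `η`. -/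
theorem probRatioGE_le (hν : IsAdmissible F ν) {D : ℕ} {α : ℝ} {N : ℕ → ℕ} {T : ℕ}
    (z : Fin T → Fin K) (i : Fin K) {n : ℕ} (l : (Fin n → A) → ℝ)
    {X : (Fin K → Fin d → ℝ) → ℝ} (hX : ∀ᵐ θ ∂ν, limitRatio F p D i l θ ≤ X θ) {r₀ η r : ℝ}
    (hr : r₀ + η < r) :
    probRatioGE F ν D α N z i l r
      ≤ ν {θ | r₀ ≤ X θ} + ENNReal.ofReal (∫ θ, deviationProb F p D α N z i l η θ ∂ν) := by
  have := hν.prob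
  rw [ofReal_integral_eq_lintegral_ofReal (hν.integrable_deviationProb D α N z i l η)
    (Eventually.of_forall fun θ => deviationProb_nonneg D α N z i l η θ)]
  calc probRatioGE F ν D α N z i l r
      ≤ ∫⁻ θ, ({θ | r₀ ≤ X θ}.indicator 1 θ +
          ENNReal.ofReal (deviationProb F p D α N z i l η θ)) ∂ν := by
        refine lintegral_mono_ae ?_
        filter_upwards [hX] with θ hθ
        by_cases hXθ : r₀ ≤ X θ
        · rw [Set.indicator_of_mem (show θ ∈ {θ | r₀ ≤ X θ} from hXθ), Pi.one_apply]
          refine le_trans ?_ le_self_add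
          rw [← ENNReal.ofReal_one]
          refine ENNReal.ofReal_le_ofReal ?_
          rw [← sum_memoryProb (F := F) (θ := θ) (N := N) z]
          refine Finset.sum_le_sum fun y _ => ?_
          split_ifs
          exacts [le_rfl, memoryProb_nonneg z y]
        · refine le_trans (ENNReal.ofReal_le_ofReal ?_) le_add_self
          refine Finset.sum_le_sum fun y _ => ?_
          have hy0 := memoryProb_nonneg (F := F) (θ := θ) z y
          split_ifs with h1 h2 h2
          · rw [mul_one]
          · exfalso
            rw [not_le] at h2 hXθ
            linarith [(abs_lt.1 h2).2]
          · rwa [mul_one]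
          · rw [mul_zero]
    _ = ∫⁻ θ, {θ | r₀ ≤ X θ}.indicator 1 θ ∂ν +
          ∫⁻ θ, ENNReal.ofReal (deviationProb F p D α N z i l η θ) ∂ν :=
        lintegral_add_right' _ (hν.aemeasurable_deviationProb D α N z i l η).ennreal_ofReal
    _ ≤ _ := by
        gcongr
        exact lintegral_indicator_one_le _

theorem exists_measure_le_lt {Ω : Type*} [MeasurableSpace Ω] {μ : Measure Ω} [IsFiniteMeasure μ]
    {X : Ω → ℝ} (hX : AEMeasurable X μ) {c : ENNReal} (hc : 0 < c) :
    ∃ b : ℝ, 0 ≤ b ∧ μ {ω | b ≤ X ω} < c := by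
  have h1 : Tendsto (fun n : ℕ => μ {ω | (n : ℝ) ≤ X ω}) atTop
      (𝓝 (μ (⋂ n : ℕ, {ω | (n : ℝ) ≤ X ω}))) := by
    refine tendsto_measure_iInter_atTop (fun n => nullMeasurableSet_le aemeasurable_const hX)
      (fun m n hmn ω hω => ?_) ⟨0, measure_ne_top _ _⟩
    have h1 : (m : ℝ) ≤ n := by exact_mod_cast hmn
    have h2 : (n : ℝ) ≤ X ω := hω
    exact h1.trans h2
  have h2 : (⋂ n : ℕ, {ω | (n : ℝ) ≤ X ω}) = ∅ := by
    refine Set.eq_empty_iff_forall_notMem.2 fun ω hω => ?_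
    obtain ⟨n, hn⟩ := exists_nat_gt (X ω)
    exact absurd (Set.mem_iInter.1 hω n) (not_le.2 hn)
  rw [h2, measure_empty] at h1
  obtain ⟨n, hn⟩ := (h1.eventually (gt_mem_nhds hc)).exists
  exact ⟨n, n.cast_nonneg, hn⟩

theorem exists_lt_one_measure_le_lt {Ω : Type*} [MeasurableSpace Ω] {μ : Measure Ω}
    [IsFiniteMeasure μ] {X : Ω → ℝ} (hX : AEMeasurable X μ) {c : ENNReal}
    (hc : μ {ω | 1 ≤ X ω} < c) : ∃ r : ℝ, 0 ≤ r ∧ r < 1 ∧ μ {ω | r ≤ X ω} < c := by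
  have h1 : Tendsto (fun n : ℕ => μ {ω | 1 - 1 / ((n : ℝ) + 1) ≤ X ω}) atTop
      (𝓝 (μ (⋂ n : ℕ, {ω | 1 - 1 / ((n : ℝ) + 1) ≤ X ω}))) := by
    refine tendsto_measure_iInter_atTop (fun n => nullMeasurableSet_le aemeasurable_const hX)
      (fun m n hmn ω hω => ?_) ⟨0, measure_ne_top _ _⟩
    have h1 : (m : ℝ) + 1 ≤ n + 1 := by exact_mod_cast Nat.succ_le_succ hmn
    have h2 : 1 - 1 / ((n : ℝ) + 1) ≤ X ω := hω
    exact (sub_le_sub_left (one_div_le_one_div_of_le (by positivity) h1) 1).trans h2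
  have h2 : (⋂ n : ℕ, {ω | 1 - 1 / ((n : ℝ) + 1) ≤ X ω}) = {ω | 1 ≤ X ω} := by
    ext ω
    simp only [Set.mem_iInter, Set.mem_ofPred_eq]
    refine ⟨fun hω => ?_, fun hω n => le_trans (sub_le_self _ (by positivity)) hω⟩
    have h3 := (tendsto_one_div_add_atTop_nhds_zero_nat (𝕜 := ℝ)).const_sub 1
    rw [sub_zero] at h3
    exact le_of_tendsto' h3 hω
  rw [h2] at h1
  obtain ⟨n, hn⟩ := (h1.eventually (gt_mem_nhds hc)).exists
  have h3 : (0 : ℝ) < (n : ℝ) + 1 := by positivity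
  refine ⟨_, ?_, sub_lt_self _ (one_div_pos.2 h3), hn⟩
  rw [sub_nonneg, div_le_one h3]
  linarith [n.cast_nonneg (α := ℝ)]

/-- The levels that the length ratio reaches with probability at least `1 - ε` are bounded, uniformly
in the memory. -/
theorem exists_forall_le_of_probRatioGE [Nontrivial A] (hν : IsAdmissible F ν) (D : ℕ) {α : ℝ}
    (hα : 0 < α) (N : ℕ → ℕ) (i : Fin K) {n : ℕ} (hn : 1 ≤ n) {l : (Fin n → A) → ℝ}
    (hl : IsLengthFunction l) {ε : ℝ} (hε : ε < 1) :
    ∃ b : ℝ, 0 ≤ b ∧ ∀ (T : ℕ) (z : Fin T → Fin K) (r : ℝ),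
      ENNReal.ofReal (1 - ε) ≤ probRatioGE F ν D α N z i l r → r ≤ b := by
  have := hν.prob
  have hm : AEMeasurable (fun θ => expect (F.source (θ i)) l / entropy (F.source (θ i)) n) ν :=
    (hν.aemeasurable_expect_const i _).div (hν.aemeasurable_entropy i n)
  obtain ⟨b, hb0, hb⟩ := exists_measure_le_lt hm (ENNReal.ofReal_pos.2 (sub_pos.2 hε))
  refine ⟨b, hb0, fun T z r hr => ?_⟩
  by_contra hrb
  rw [not_le] at hrb
  set S := {θ : Fin K → Fin d → ℝ | b ≤ expect (F.source (θ i)) l / entropy (F.source (θ i)) n}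
    with hS
  refine absurd (hr.trans ?_) (not_le.2 hb)
  refine le_trans (b := ∫⁻ θ, S.indicator 1 θ ∂ν) (lintegral_mono_ae ?_)
    (lintegral_indicator_one_le _)
  filter_upwards [hν.mem] with θ hθ
  have hQ := fun y : Memory A N T => lengthRatio_mem (F.pos _ (hθ i)) hn hl D hα y
  by_cases hbθ : θ ∈ S
  · rw [Set.indicator_of_mem hbθ, Pi.one_apply, ← ENNReal.ofReal_one]
    refine ENNReal.ofReal_le_ofReal ?_
    rw [← sum_memoryProb (F := F) (θ := θ) (N := N) z]
    refine Finset.sum_le_sum fun y _ => ?_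
    split_ifs
    exacts [le_rfl, memoryProb_nonneg z y]
  · refine le_of_eq_of_le (ENNReal.ofReal_eq_zero.2 ?_) zero_le
    refine le_of_eq (Finset.sum_eq_zero fun y _ => if_neg fun hy => hbθ ?_)
    rw [hS, Set.mem_ofPred_eq]
    exact hrb.le.trans (hy.trans (hQ y).2)

/-- The memorization gain is asymptotically at most every level that an upper bound `X` of the
limit ratio reaches with probability less than `1 - ε`. -/
theorem eventually_gainM_le [Nontrivial A] (hν : IsAdmissible F ν) (hK : 2 ≤ K)
    (hp : ∀ i, 0 < p i) (hp1 : ∑ i, p i = 1) {D : ℕ} {α : ℝ} (hα : 0 < α) {N : ℕ → ℕ}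
    (hN : ∀ j, D < N j)
    (hN' : Tendsto (fun T : ℕ => (N T : ℝ) / ∑ j ∈ Finset.range T, (N j : ℝ)) atTop (𝓝 0))
    (i : Fin K) {n : ℕ} (hn : 1 ≤ n) {l : (Fin n → A) → ℝ} (hl : IsLengthFunction l)
    {X : (Fin K → Fin d → ℝ) → ℝ} (hX : ∀ᵐ θ ∂ν, limitRatio F p D i l θ ≤ X θ)
    {ε : ℝ} (hε : ε < 1) {r₀ : ℝ} (hr₀ : 0 ≤ r₀) (hr : ν {θ | r₀ ≤ X θ} < ENNReal.ofReal (1 - ε))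
    {δ : ℝ} (hδ : 0 < δ) : ∀ᶠ T in atTop, gainM F ν p D α N i l ε T ≤ r₀ + δ := by
  have := hν.prob
  obtain ⟨b, hb0, hb⟩ := exists_forall_le_of_probRatioGE hν D hα N i hn hl hε
  set s : ℝ := (ν {θ | r₀ ≤ X θ}).toReal with hs
  have hs' : ν {θ | r₀ ≤ X θ} = ENNReal.ofReal s := (ENNReal.ofReal_toReal (measure_ne_top _ _)).symm
  have hs0 : 0 ≤ s := ENNReal.toReal_nonneg
  -- If a deviation has probability less than the slack `γ`, the gain is at most `r₀ + δ / 2`;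
  -- otherwise the uniform bound `b` applies, and this is rare by Markov's inequality.
  set γ : ℝ := 1 - ε - s with hγ
  have hγ0 : 0 < γ := by
    rw [hs', ENNReal.ofReal_lt_ofReal_iff (sub_pos.2 hε)] at hr
    exact sub_pos.2 hr
  have hβ0 : ∀ {T : ℕ} (z : Fin T → Fin K),
      0 ≤ ∫ θ, deviationProb F p D α N z i l (δ / 2) θ ∂ν := fun z =>
    integral_nonneg fun θ => deviationProb_nonneg D α N z i l _ θ
  have hw : ∀ {T : ℕ} (z : Fin T → Fin K), 0 ≤ ∏ j, p (z j) := fun z =>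
    Finset.prod_nonneg fun j _ => (hp _).le
  have hgain : ∀ {T : ℕ} (z : Fin T → Fin K), gain F ν D α N z i l ε
      ≤ r₀ + δ / 2 + b / γ * ∫ θ, deviationProb F p D α N z i l (δ / 2) θ ∂ν := by
    intro T z
    rcases lt_or_ge (∫ θ, deviationProb F p D α N z i l (δ / 2) θ ∂ν) γ with h1 | h1
    · have h2 : gain F ν D α N z i l ε ≤ r₀ + δ / 2 := by
        refine Real.sSup_le (fun r hrS => ?_) (by positivity)
        by_contra hcon
        rw [not_le] at hcon
        have h3 := hrS.trans (probRatioGE_le hν z i l hX hcon)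
        rw [hs', ← ENNReal.ofReal_add hs0 (hβ0 z),
          ENNReal.ofReal_le_ofReal_iff (add_nonneg hs0 (hβ0 z))] at h3
        linarith
      have := mul_nonneg (div_nonneg hb0 hγ0.le) (hβ0 z)
      linarith
    · have h2 : gain F ν D α N z i l ε ≤ b := Real.sSup_le (fun r hrS => hb T z r hrS) hb0
      have h3 : b ≤ b / γ * ∫ θ, deviationProb F p D α N z i l (δ / 2) θ ∂ν := by
        calc b = b / γ * γ := (div_mul_cancel₀ _ hγ0.ne').symm
          _ ≤ _ := mul_le_mul_of_nonneg_left h1 (div_nonneg hb0 hγ0.le)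
      linarith
  have hlim := (tendsto_mean_deviationProb hν hK hp hp1 hα hN hN' i hn l
    (half_pos hδ)).const_mul (b / γ)
  rw [mul_zero] at hlim
  filter_upwards [hlim.eventually (gt_mem_nhds (half_pos hδ))] with T hT
  calc gainM F ν p D α N i l ε T
      ≤ ∑ z : Fin T → Fin K, (∏ j, p (z j)) *
          (r₀ + δ / 2 + b / γ * ∫ θ, deviationProb F p D α N z i l (δ / 2) θ ∂ν) :=
        Finset.sum_le_sum fun z _ => mul_le_mul_of_nonneg_left (hgain z) (hw z)
    _ = r₀ + δ / 2 + b / γ * ∑ z : Fin T → Fin K, (∏ j, p (z j)) *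
          ∫ θ, deviationProb F p D α N z i l (δ / 2) θ ∂ν := by
        simp only [mul_add, Finset.sum_add_distrib, ← Finset.sum_mul, sum_prod_weights hp1,
          one_mul, Finset.mul_sum]
        congr 1
        exact Finset.sum_congr rfl fun z _ => by ring
    _ ≤ r₀ + δ := by linarith

/-- For given parameter vectors the memorization gain converges to the limit ratio. -/
theorem tendsto_gainM_dirac [Nontrivial A] {θ : Fin K → Fin d → ℝ} (hθ : ∀ i, θ i ∈ F.Θ)
    (hK : 2 ≤ K) (hp : ∀ i, 0 < p i) (hp1 : ∑ i, p i = 1) {D : ℕ} {α : ℝ} (hα : 0 < α)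
    {N : ℕ → ℕ} (hN : ∀ j, D < N j)
    (hN' : Tendsto (fun T : ℕ => (N T : ℝ) / ∑ j ∈ Finset.range T, (N j : ℝ)) atTop (𝓝 0))
    (i : Fin K) {n : ℕ} (hn : 1 ≤ n) {l : (Fin n → A) → ℝ} (hl : IsLengthFunction l)
    {ε : ℝ} (hε : ε ∈ Set.Ioo (0 : ℝ) 1) :
    Tendsto (gainM F (Measure.dirac θ) p D α N i l ε) atTop (𝓝 (limitRatio F p D i l θ)) := by
  have hν : IsAdmissible F (Measure.dirac θ) := IsAdmissible.dirac hθ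
  have hQ0 : 0 ≤ limitRatio F p D i l θ := div_nonneg
    ((entropy_nonneg _ _).trans (entropy_le_expect (F.pos _ (hθ i)) hl))
    (entropy_add_divergence_pos hK hp hθ D i hn).le
  set q := limitRatio F p D i l θ with hq
  obtain ⟨b, hb0, hb⟩ := exists_forall_le_of_probRatioGE hν D hα N i hn hl hε.2
  have hw : ∀ {T : ℕ} (z : Fin T → Fin K), 0 ≤ ∏ j, p (z j) := fun z =>
    Finset.prod_nonneg fun j _ => (hp _).le
  refine tendsto_order.2 ⟨fun r hr => ?_, fun r hr => ?_⟩
  · set η := (q - r) / 2 with hη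
    have hη0 : 0 < η := half_pos (sub_pos.2 hr)
    have hmem : ∀ {T : ℕ} (z : Fin T → Fin K) (r : ℝ),
        1 - ε ≤ ∑ y : Memory A N T, (if r ≤ lengthRatio (F.source (θ i)) l D α y then
          memoryProb F θ z y else 0) → r ≤ gain F (Measure.dirac θ) D α N z i l ε := by
      intro T z r hr
      refine le_csSup ⟨b, fun r hrS => hb T z r hrS⟩ ?_
      rw [Set.mem_ofPred_eq, probRatioGE, lintegral_dirac]
      refine ENNReal.ofReal_le_ofReal (hr.trans (le_of_eq ?_))
      exact Finset.sum_congr rfl fun y _ => by congr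
    have hgain0 : ∀ {T : ℕ} (z : Fin T → Fin K),
        0 ≤ gain F (Measure.dirac θ) D α N z i l ε := by
      intro T z
      refine hmem z 0 ?_
      rw [Finset.sum_congr rfl fun y _ =>
        if_pos (lengthRatio_mem (F.pos _ (hθ i)) hn hl D hα y).1, sum_memoryProb]
      linarith [hε.1]
    -- If a deviation has probability at most `ε`, the level `q - η` is reached; otherwise the left
    -- side is negative.
    have hgain : ∀ {T : ℕ} (z : Fin T → Fin K),
        q - η - q / ε * deviationProb F p D α N z i l η θ
          ≤ gain F (Measure.dirac θ) D α N z i l ε := by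
      intro T z
      have hd0 := deviationProb_nonneg (F := F) (p := p) D α N z i l η θ
      rcases le_total (deviationProb F p D α N z i l η θ) ε with h1 | h1
      · have h2 : q - η ≤ gain F (Measure.dirac θ) D α N z i l ε := by
          refine hmem z _ (le_trans (sub_le_sub_left h1 1) ?_)
          rw [← sum_memoryProb (F := F) (θ := θ) (N := N) z, deviationProb,
            ← Finset.sum_sub_distrib]
          refine Finset.sum_le_sum fun y _ => ?_
          have hy0 := memoryProb_nonneg (F := F) (θ := θ) z y
          split_ifs with h2 h3 h3
          · linarith
          · linarith
          · linarith
          · exfalso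
            rw [not_le] at h2 h3
            linarith [(abs_lt.1 h2).1]
        have := mul_nonneg (div_nonneg hQ0 hε.1.le) hd0
        linarith
      · have h2 : q ≤ q / ε * deviationProb F p D α N z i l η θ := by
          calc q = q / ε * ε := (div_mul_cancel₀ _ hε.1.ne').symm
            _ ≤ _ := mul_le_mul_of_nonneg_left h1 (div_nonneg hQ0 hε.1.le)
        linarith [hgain0 z]
    have hlim := (tendsto_mean_deviationProb hν hK hp hp1 hα hN hN' i hn l hη0).const_mul (q / ε)
    rw [mul_zero] at hlim
    filter_upwards [hlim.eventually (gt_mem_nhds hη0)] with T hT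
    simp only [integral_dirac] at hT
    calc r = q - η - η := by rw [hη]; ring
      _ < q - η - q / ε * ∑ z : Fin T → Fin K, (∏ j, p (z j)) *
          deviationProb F p D α N z i l η θ := by linarith
      _ = ∑ z : Fin T → Fin K, (∏ j, p (z j)) *
          (q - η - q / ε * deviationProb F p D α N z i l η θ) := by
        simp only [mul_sub, Finset.sum_sub_distrib, ← Finset.sum_mul, sum_prod_weights hp1,
          one_mul, Finset.mul_sum]
        congr 1
        exact Finset.sum_congr rfl fun z _ => by ring
      _ ≤ gainM F (Measure.dirac θ) p D α N i l ε T :=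
        Finset.sum_le_sum fun z _ => mul_le_mul_of_nonneg_left (hgain z) (hw z)
  · set η := (r - q) / 3 with hη
    have hη0 : 0 < η := by rw [hη]; linarith
    have hr0 : Measure.dirac θ {θ' : Fin K → Fin d → ℝ | q + η ≤ q} < ENNReal.ofReal (1 - ε) := by
      have h1 : {θ' : Fin K → Fin d → ℝ | q + η ≤ q} = ∅ :=
        Set.eq_empty_iff_forall_notMem.2 fun θ' hθ' => by
          have h2 : q + η ≤ q := hθ'
          linarith
      rw [h1, measure_empty]
      exact ENNReal.ofReal_pos.2 (sub_pos.2 hε.2)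
    have h1 := eventually_gainM_le hν hK hp hp1 hα hN hN' i hn hl (X := fun _ => q)
      (by rw [ae_dirac_eq]; exact hq.ge) hε.2 (add_nonneg hQ0 hη0.le) hr0 hη0
    filter_upwards [h1] with T hT
    refine hT.trans_lt ?_
    rw [hη]
    linarith

end Gain

/-- A level above the quantile is reached with probability less than `1 - ε`. Measurability makes the
set of reached levels bounded, so that its supremum is not a junk value. -/
theorem measure_le_lt_of_reachedLevel_lt {Ω : Type*} [MeasurableSpace Ω] {μ : Measure Ω}
    [IsFiniteMeasure μ] {X : Ω → ℝ} (hX : AEMeasurable X μ) {ε : ℝ} (hε : ε < 1) {r : ℝ}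
    (hr : reachedLevel μ ε X < r) : μ {ω | r ≤ X ω} < ENNReal.ofReal (1 - ε) := by
  obtain ⟨b, hb0, hb⟩ := exists_measure_le_lt hX (ENNReal.ofReal_pos.2 (sub_pos.2 hε))
  by_contra hcon
  rw [not_lt] at hcon
  refine absurd (le_csSup ⟨b, fun s hs => ?_⟩ hcon) (not_le.2 hr)
  by_contra hsb
  rw [not_le] at hsb
  exact absurd (le_trans hs (measure_mono fun ω hω => hsb.le.trans hω)) (not_le.2 hb)

theorem reachedLevel_nonneg {Ω : Type*} [MeasurableSpace Ω] {μ : Measure Ω}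
    [IsProbabilityMeasure μ] {X : Ω → ℝ} (hX : ∀ᵐ ω ∂μ, 0 ≤ X ω) {ε : ℝ} (hε : 0 ≤ ε) :
    0 ≤ reachedLevel μ ε X := by
  refine Real.sSup_nonneg' ⟨0, ?_, le_rfl⟩
  have h1 : μ {ω | 0 ≤ X ω} = 1 := by
    rw [← measure_univ (μ := μ)]
    exact measure_congr (hX.mono fun ω hω => propext ⟨fun _ => trivial, fun _ => hω⟩)
  rw [Set.mem_ofPred_eq, h1, ← ENNReal.ofReal_one]
  exact ENNReal.ofReal_le_ofReal (by linarith)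

/-! ### Comparison with the main term -/

/-- The redundancy constant `c` of a universal code changes the ratio by at most a multiple of
`1 / n`. -/
theorem limitRatio_le_mainTerm_add {A : Type*} [Fintype A] [Nontrivial A] {d h : ℕ}
    {F : ParametricFamily A d h} {K : ℕ} (hK : 2 ≤ K) {p : Fin K → ℝ} (hp : ∀ i, 0 < p i)
    {θ : Fin K → Fin d → ℝ} (hθ : ∀ i, θ i ∈ F.Θ) (D : ℕ) (i : Fin K) {n : ℕ} (hn : 1 ≤ n)
    {l : (Fin n → A) → ℝ} {c : ℝ}
    (hc : redundancy (F.source (θ i)) l ≤ F.minimaxRedundancy n + c) :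
    limitRatio F p D i l θ ≤ mainTerm F p θ D i n +
      |c| * symbolsPerBit (treeCond (mixtureProb F p θ) D) D / n := by
  have hm := mixtureProb_pos hK hp hθ
  have hL := entropy_add_divergence_pos hK hp hθ D i hn
  have h1 := le_symbolsPerBit_mul (F.pos _ (hθ i)) (treeCond_pos hm D)
    (sum_treeCond hm (mixtureProb_append F p θ) D) (rtake_treeCond _ D) n
  rw [← treeMixture_eq_seqCode] at h1
  have hn0 : (0 : ℝ) < n := by exact_mod_cast hn
  rw [redundancy] at hc
  rw [limitRatio, mainTerm]
  set L := entropy (F.source (θ i)) n + divergence (F.source (θ i)) (treeMixture F p θ D n)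
  set S := symbolsPerBit (treeCond (mixtureProb F p θ) D) D
  calc expect (F.source (θ i)) l / L
      ≤ (entropy (F.source (θ i)) n + F.minimaxRedundancy n + |c|) / L := by
        gcongr
        linarith [le_abs_self c]
    _ = (entropy (F.source (θ i)) n + F.minimaxRedundancy n) / L + |c| / L := add_div _ _ _
    _ ≤ _ := by
        gcongr 1
        rw [div_le_div_iff₀ hL hn0, mul_assoc]
        exact mul_le_mul_of_nonneg_left h1 (abs_nonneg c)

theorem tendsto_measure_one_le {Ω : Type*} [MeasurableSpace Ω] {μ : Measure Ω} [IsFiniteMeasure μ]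
    {X : ℕ → Ω → ℝ} (hX : ∀ n, AEMeasurable (X n) μ) (h : ∀ᵐ ω ∂μ, ∀ᶠ n in atTop, X n ω < 1) :
    Tendsto (fun n => μ {ω | 1 ≤ X n ω}) atTop (𝓝 0) := by
  have h1 : ∀ᵐ ω ∂μ, ∀ n, X n ω = (hX n).mk _ ω := ae_all_iff.2 fun n => (hX n).ae_eq_mk
  have h2 : ∀ n, μ {ω | 1 ≤ (hX n).mk _ ω} = μ {ω | 1 ≤ X n ω} := fun n =>
    measure_congr (h1.mono fun ω hω => by
      change (1 ≤ (hX n).mk _ ω) = (1 ≤ X n ω)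
      rw [hω n])
  rw [← measure_empty (μ := μ)]
  refine (tendsto_measure_of_ae_tendsto_indicator_of_isFiniteMeasure atTop MeasurableSet.empty
    (fun n => measurableSet_le measurable_const (hX n).measurable_mk) ?_).congr h2
  filter_upwards [h, h1] with ω hω hω1
  filter_upwards [hω] with n hn
  rw [hω1 n] at hn
  exact iff_of_false (not_le.2 hn) (Set.notMem_empty ω)

end MemoryAssisted

open MemoryAssisted in
theorem proposition2 {A : Type*} [Fintype A] [DecidableEq A] {d h : ℕ} (hd : 1 ≤ d)
    (F : ParametricFamily A d h) (hJ : F.jeffreysMass ≠ 0) (hJ' : F.jeffreysMass ≠ ⊤)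
    {K : ℕ} (hK : 2 ≤ K) (p : Fin K → ℝ) (hp : ∀ i, 0 < p i) (hp1 : ∑ i, p i = 1)
    (D : ℕ) (α : ℝ) (hα : 0 < α)
    (N : ℕ → ℕ) (hN : ∀ j, D < N j)
    (hN' : Tendsto (fun T : ℕ => (N T : ℝ) / ∑ j ∈ Finset.range T, (N j : ℝ)) atTop (𝓝 0))
    (l : ∀ n, (Fin n → A) → ℝ) (hl : F.IsUniversal l) :
    ∃ C : (Fin K → Fin d → ℝ) → ℝ, Measurable C ∧
      -- for given parameter vectors, with probability one
      (∀ᵐ θ ∂(F.prior K), ∀ i : Fin K,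
        (∃ g : ℕ → ℝ → ℝ,
          (∀ n, 1 ≤ n → ∀ ε ∈ Set.Ioo (0 : ℝ) 1,
            Tendsto (fun T => gainM F (Measure.dirac θ) p D α N i (l n) ε T) atTop (𝓝 (g n ε)) ∧
            g n ε ≤ mainTerm F p θ D i n + C θ / n) ∧
          ∀ᶠ n in atTop, ∀ ε ∈ Set.Ioo (0 : ℝ) 1, g n ε < 1) ∧
        (fun n : ℕ => divergence (F.source (θ i)) (treeMixture F p θ D n))
          =Θ[atTop] (fun n : ℕ => (n : ℝ))) ∧
      -- for the fraction of sources measured by Jeffreys' prior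
      (∀ i : Fin K, ∀ ε ∈ Set.Ioo (0 : ℝ) 1,
        (∀ n, 1 ≤ n → ∀ δ > 0, ∀ᶠ T in atTop,
          gainM F (F.prior K) p D α N i (l n) ε T ≤
            reachedLevel (F.prior K) ε (fun θ => mainTerm F p θ D i n + C θ / n) + δ) ∧
        ∀ᶠ n in atTop, ∃ r < 1, ∀ᶠ T in atTop,
          gainM F (F.prior K) p D α N i (l n) ε T ≤ r) := by
  obtain ⟨hlen, c, hc⟩ := hl
  have hnt : Nontrivial A := F.nontrivial_alphabet hd hJ hJ'
  have hν : IsAdmissible F (F.prior K) := isAdmissible_prior hJ hJ'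
  have hprob := hν.prob
  have hS := hν.aemeasurable_symbolsPerBit (p := p) D
  have hk := F.ae_condDivergence_pos hd hJ hJ' hK hp D
  -- The function `symbolsPerBit` need not be measurable where the parameters are not in `Θ`; a
  -- measurable version of it gives `C`.
  have hCm : Measurable fun θ => |c| * hS.mk _ θ := hS.measurable_mk.const_mul _
  have hle : ∀ᵐ θ ∂F.prior K, ∀ i n, 1 ≤ n →
      limitRatio F p D i (l n) θ ≤ mainTerm F p θ D i n + |c| * hS.mk _ θ / n := by
    filter_upwards [hν.mem, hS.ae_eq_mk] with θ hθ hSθ i n hn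
    rw [← hSθ]
    exact limitRatio_le_mainTerm_add hK hp hθ D i hn (hc n _ (hθ i))
  have hlt : ∀ᵐ θ ∂F.prior K, ∀ i, ∀ᶠ n : ℕ in atTop,
      mainTerm F p θ D i n + |c| * hS.mk _ θ / n < 1 := by
    filter_upwards [hν.mem, hk] with θ hθ hkθ i
    exact eventually_mainTerm_add_lt_one hK hp hθ D i (hkθ i) _
  have hX : ∀ i n, AEMeasurable
      (fun θ => mainTerm F p θ D i n + |c| * hS.mk _ θ / n) (F.prior K) := fun i n =>
    (hν.aemeasurable_mainTerm D i n).fun_add (hCm.div_const _).aemeasurable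
  refine ⟨fun θ => |c| * hS.mk _ θ, hCm, ?_, fun i ε hε => ⟨fun n hn δ hδ => ?_, ?_⟩⟩
  · filter_upwards [hν.mem, hk, hle, hlt] with θ hθ hkθ hleθ hltθ i
    refine ⟨⟨fun n _ => limitRatio F p D i (l n) θ, fun n hn ε hε =>
      ⟨tendsto_gainM_dirac hθ hK hp hp1 hα hN hN' i hn (hlen n) hε, hleθ i n hn⟩, ?_⟩,
      isTheta_divergence hK hp hθ D i (hkθ i)⟩
    filter_upwards [hltθ i, eventually_ge_atTop 1] with n hn hn1 ε _
    exact (hleθ i n hn1).trans_lt hn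
  · have hX0 : ∀ᵐ θ ∂F.prior K, 0 ≤ mainTerm F p θ D i n + |c| * hS.mk _ θ / n := by
      filter_upwards [hν.mem, hle] with θ hθ hleθ
      refine le_trans ?_ (hleθ i n hn)
      exact div_nonneg ((entropy_nonneg _ _).trans
        (entropy_le_expect (F.pos _ (hθ i)) (hlen n)))
        (entropy_add_divergence_pos hK hp hθ D i hn).le
    have h1 := reachedLevel_nonneg hX0 hε.1.le
    have h2 := measure_le_lt_of_reachedLevel_lt (hX i n) hε.2 (lt_add_of_pos_right _ (half_pos hδ))
    filter_upwards [eventually_gainM_le hν hK hp hp1 hα hN hN' i hn (hlen n)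
      (hle.mono fun θ hθ => hθ i n hn) hε.2 (add_nonneg h1 (half_pos hδ).le) h2
      (half_pos hδ)] with T hT
    linarith
  · have h1 : Tendsto (fun n : ℕ => F.prior K
        {θ | 1 ≤ mainTerm F p θ D i n + |c| * hS.mk _ θ / n}) atTop (𝓝 0) :=
      tendsto_measure_one_le (hX i) (hlt.mono fun θ hθ => hθ i)
    filter_upwards [h1.eventually (gt_mem_nhds (ENNReal.ofReal_pos.2 (sub_pos.2 hε.2))),
      eventually_ge_atTop 1] with n hn hn1
    obtain ⟨r, hr0, hr1, hr⟩ := exists_lt_one_measure_le_lt (hX i n) hn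
    refine ⟨r + (1 - r) / 2, by linarith, ?_⟩
    exact eventually_gainM_le hν hK hp hp1 hα hN hN' i hn1 (hlen n)
      (hle.mono fun θ hθ => hθ i n hn1) hε.2 hr0 hr (half_pos (sub_pos.2 hr1))
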